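/- Let $\Gamma$ be a compact metric graph, not necessarily connected: finite sets of vertices and edges (at least one edge; loops and multiple edges allowed), each edge $e$ being a segment $[0,L_e]$ with $0<L_e<\infty$. Let $W\in L^2(\Gamma)$ be a real potential, and let $v$ be a distinguished vertex. For a function $f$ that is $H^2$ on every edge and a vertex $u$ of degree $d_u$ (a loop counts twice), let $F(u),F'(u)\in\mathbb{C}^{d_u}$ be the vectors of values at $u$ of $f$ and of its derivatives, taken into the edges, along the edge ends incident to $u$. At every vertex $u\neq v$ fix an arbitrary self-adjoint vertex condition $A_uF(u)+B_uF'(u)=0$, where $A_u,B_u$ are $d_u\times d_u$ complex matrices such that $(A_u\ B_u)$ has rank $d_u$ and $A_uB_u^*$ is self-adjoint. For $\alpha\in\mathbb{R}$ let $\Gamma_\alpha$ denote the graph with the Hamiltonian $f\mapsto -f''+Wf$ on $L^2(\Gamma)$, whose domain consists of all complex functions $f$ that are $H^2$ on every edge, satisfy the fixed conditions at all $u\ne v$, and satisfy at $v$ the $\delta$-type condition: $f$ is continuous at $v$ and $\sum f'(v)=\alpha f(v)$, where $\sum f'(v)$ is the sum of the entries of $F'(v)$. Let $\Gamma_\infty$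 be defined in the same way with the Dirichlet condition $f(v)=0$ (on all edge ends at $v$) in place of the $\delta$-type condition. Let $-\infty<\alpha<\alpha'\le\infty$. Then, for both $\Gamma_\alpha$ and $\Gamma_{\alpha'}$, the eigenvalues of the Hamiltonian can be listed as an infinite non-decreasing sequence $\lambda_1\le\lambda_2\le\cdots$ of real numbers in which each eigenvalue is repeated according to its multiplicity, and for all $n\ge1$ $$\lambda_n(\Gamma_\alpha)\le\lambda_n(\Gamma_{\alpha'})\le\lambda_{n+1}(\Gamma_\alpha).$$ If moreover $\lambda_n(\Gamma_{\alpha'})$ is a simple eigenvalue and its eigenfunction $f$ satisfies $f(v)\ne0$ or $\sum f'(v)\neq0$, then $$\lambda_n(\Gamma_\alpha)<\lambda_n(\Gamma_{\alpha'})<\lambda_{n+1}(\Gamma_\alpha).$$ -/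

import Mathlib

open MeasureTheory Set

/-- A compact metric graph with vertex set `V` and edge set `E`; loops, multiple edges and several
connected components are allowed. The edge `e` is the segment `[0, len e]`; its end `x = 0` is
attached to the vertex `endpt e false`, its end `x = len e` to `endpt e true`. -/
structure MetricGraph (V E : Type*) where
  endpt : E → Bool → V
  len : E → ℝ
  len_pos : ∀ e, 0 < len e

/-- Vertex conditions `A F + B F' = 0` on the boundary data indexed by `ι` (the edge ends at a
vertex) that are self-adjoint: `(A B)` has maximal rank and `A B*` is Hermitian. -/
structure SelfAdjointCondition (ι : Type*) [Fintype ι] where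
  A : Matrix ι ι ℂ
  B : Matrix ι ι ℂ
  rank_eq : (Matrix.fromCols A B).rank = Fintype.card ι
  hermitian : (A * B.conjTranspose).IsHermitian

namespace MetricGraph

variable {V E : Type*} (Γ : MetricGraph V E)

/-- The edge ends incident to `v`; a loop at `v` contributes two of them. The cardinality is the
degree of `v`. -/
abbrev Star (v : V) : Type _ := {b : E × Bool // Γ.endpt b.1 b.2 = v}

/-- Complex-valued functions on the disjoint union of the closed edges. -/
abbrev Fun : Type _ := (e : E) → Icc (0 : ℝ) (Γ.len e) → ℂ

variable {Γ}

/-- The restriction of `f` to the edge `e`, extended constantly to the whole line. -/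
noncomputable def onEdge (f : Γ.Fun) (e : E) : ℝ → ℂ := IccExtend (Γ.len_pos e).le (f e)

/-- The derivative of `f` in the coordinate of the edge `e` (one-sided at the two ends). -/
noncomputable def edgeDeriv (f : Γ.Fun) (e : E) (x : ℝ) : ℂ :=
  derivWithin (onEdge f e) (Icc 0 (Γ.len e)) x

/-- On `[0, L]`, `f` is absolutely continuous with derivative `g` in `L²(0, L)`; so
`f ∈ H¹(0, L)` with weak derivative `g`, and `f` is the continuous representative. -/
def HasL2Deriv (L : ℝ) (f g : ℝ → ℂ) : Prop :=
  MemLp g 2 (volume.restrict (Ioc 0 L)) ∧ ∀ x ∈ Icc 0 L, f x = f 0 + ∫ t in (0 : ℝ)..x, g t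

/-- On the edge `e`, `f` belongs to `H²(e)` with second derivative `g`. -/
def HasSecondDeriv (f : Γ.Fun) (e : E) (g : ℝ → ℂ) : Prop :=
  DifferentiableOn ℝ (onEdge f e) (Icc 0 (Γ.len e)) ∧ HasL2Deriv (Γ.len e) (edgeDeriv f e) g

/-- The value of `f` at an edge end. -/
noncomputable def endVal (f : Γ.Fun) (b : E × Bool) : ℂ :=
  onEdge f b.1 (if b.2 then Γ.len b.1 else 0)

/-- The derivative of `f` at an edge end, taken away from the vertex and into the edge. -/
noncomputable def endDeriv (f : Γ.Fun) (b : E × Bool) : ℂ :=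
  if b.2 then -edgeDeriv f b.1 (Γ.len b.1) else edgeDeriv f b.1 0

/-- The vector `F(v)`. -/
noncomputable def vertexVal (f : Γ.Fun) (v : V) : Γ.Star v → ℂ := fun b => endVal f b.1

/-- The vector `F'(v)`. -/
noncomputable def vertexDeriv (f : Γ.Fun) (v : V) : Γ.Star v → ℂ := fun b => endDeriv f b.1

theorem onEdge_add (f g : Γ.Fun) (e : E) : onEdge (f + g) e = onEdge f e + onEdge g e := rfl

theorem onEdge_smul (c : ℂ) (f : Γ.Fun) (e : E) : onEdge (c • f) e = c • onEdge f e := rfl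

theorem endpts_mem (e : E) : (0 : ℝ) ∈ Icc 0 (Γ.len e) ∧ Γ.len e ∈ Icc 0 (Γ.len e) :=
  ⟨⟨le_rfl, (Γ.len_pos e).le⟩, ⟨(Γ.len_pos e).le, le_rfl⟩⟩

theorem edgeDeriv_add {f g : Γ.Fun} {e : E} {x : ℝ} (hx : x ∈ Icc 0 (Γ.len e))
    (hf : DifferentiableOn ℝ (onEdge f e) (Icc 0 (Γ.len e)))
    (hg : DifferentiableOn ℝ (onEdge g e) (Icc 0 (Γ.len e))) :
    edgeDeriv (f + g) e x = edgeDeriv f e x + edgeDeriv g e x := by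
  unfold edgeDeriv
  rw [onEdge_add]
  exact derivWithin_add (hf x hx) (hg x hx)

theorem edgeDeriv_smul (c : ℂ) {f : Γ.Fun} {e : E} {x : ℝ} (hx : x ∈ Icc 0 (Γ.len e))
    (hf : DifferentiableOn ℝ (onEdge f e) (Icc 0 (Γ.len e))) :
    edgeDeriv (c • f) e x = c * edgeDeriv f e x := by
  unfold edgeDeriv
  rw [onEdge_smul]
  exact derivWithin_const_smul c (hf x hx)

theorem HasL2Deriv.congr {L : ℝ} (hL : 0 ≤ L) {f f' g : ℝ → ℂ} (h : HasL2Deriv L f g)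
    (hff : ∀ x ∈ Icc 0 L, f' x = f x) : HasL2Deriv L f' g := by
  refine ⟨h.1, fun x hx => ?_⟩
  rw [hff x hx, hff 0 ⟨le_rfl, hL⟩]
  exact h.2 x hx

theorem HasL2Deriv.intervalIntegrable {L : ℝ} {f g : ℝ → ℂ} (h : HasL2Deriv L f g) {x : ℝ}
    (hx : x ∈ Icc 0 L) : IntervalIntegrable g volume 0 x := by
  rw [intervalIntegrable_iff_integrableOn_Ioc_of_le hx.1]
  have : IntegrableOn g (Ioc 0 L) := h.1.integrable (by norm_num)
  exact this.mono_set (Ioc_subset_Ioc_right hx.2)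

theorem HasL2Deriv.add {L : ℝ} {f f' g g' : ℝ → ℂ} (h : HasL2Deriv L f g)
    (h' : HasL2Deriv L f' g') : HasL2Deriv L (f + f') (g + g') := by
  refine ⟨h.1.add h'.1, fun x hx => ?_⟩
  simp only [Pi.add_apply]
  rw [intervalIntegral.integral_add (h.intervalIntegrable hx) (h'.intervalIntegrable hx),
    h.2 x hx, h'.2 x hx]
  ring

theorem HasL2Deriv.smul {L : ℝ} {f g : ℝ → ℂ} (c : ℂ) (h : HasL2Deriv L f g) :
    HasL2Deriv L (c • f) (c • g) := by
  refine ⟨h.1.const_smul c, fun x hx => ?_⟩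
  simp only [Pi.smul_apply]
  rw [intervalIntegral.integral_smul, h.2 x hx, smul_add]

theorem HasSecondDeriv.add {f f' : Γ.Fun} {e : E} {g g' : ℝ → ℂ} (h : HasSecondDeriv f e g)
    (h' : HasSecondDeriv f' e g') : HasSecondDeriv (f + f') e (g + g') :=
  ⟨h.1.add h'.1, (h.2.add h'.2).congr (Γ.len_pos e).le
    fun _ hx => edgeDeriv_add hx h.1 h'.1⟩

theorem HasSecondDeriv.smul (c : ℂ) {f : Γ.Fun} {e : E} {g : ℝ → ℂ} (h : HasSecondDeriv f e g) :
    HasSecondDeriv (c • f) e (c • g) :=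
  ⟨h.1.const_smul c, (h.2.smul c).congr (Γ.len_pos e).le fun _ hx => edgeDeriv_smul c hx h.1⟩

theorem vertexVal_add (f g : Γ.Fun) (v : V) :
    vertexVal (f + g) v = vertexVal f v + vertexVal g v := rfl

theorem vertexVal_smul (c : ℂ) (f : Γ.Fun) (v : V) :
    vertexVal (c • f) v = c • vertexVal f v := rfl

theorem vertexDeriv_add {f g : Γ.Fun}
    (hf : ∀ e, DifferentiableOn ℝ (onEdge f e) (Icc 0 (Γ.len e)))
    (hg : ∀ e, DifferentiableOn ℝ (onEdge g e) (Icc 0 (Γ.len e))) (v : V) :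
    vertexDeriv (f + g) v = vertexDeriv f v + vertexDeriv g v := by
  funext b
  simp only [vertexDeriv, endDeriv, Pi.add_apply]
  split_ifs
  · rw [edgeDeriv_add (endpts_mem _).2 (hf _) (hg _)]
    ring
  · rw [edgeDeriv_add (endpts_mem _).1 (hf _) (hg _)]

theorem vertexDeriv_smul (c : ℂ) {f : Γ.Fun}
    (hf : ∀ e, DifferentiableOn ℝ (onEdge f e) (Icc 0 (Γ.len e))) (v : V) :
    vertexDeriv (c • f) v = c • vertexDeriv f v := by
  funext b
  simp only [vertexDeriv, endDeriv, Pi.smul_apply, smul_eq_mul]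
  split_ifs
  · rw [edgeDeriv_smul c (endpts_mem _).2 (hf _)]
    ring
  · rw [edgeDeriv_smul c (endpts_mem _).1 (hf _)]

variable [Fintype E] [DecidableEq V]

/-- The (extended) `δ`-type condition at `v` with coefficient `α ∈ (-∞, ∞]`: `f` is continuous
at `v` and the sum of its derivatives at `v` is `α f(v)`; for `α = ∞`, `f(v) = 0`. -/
def DeltaCondition (f : Γ.Fun) (v : V) (α : WithTop ℝ) : Prop :=
  (∀ b b' : Γ.Star v, vertexVal f v b = vertexVal f v b') ∧
  match α with
  | none => ∀ b : Γ.Star v, vertexVal f v b = 0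
  | some a => ∀ b : Γ.Star v, ∑ b' : Γ.Star v, vertexDeriv f v b' = (a : ℂ) * vertexVal f v b

/-- All vertex conditions of `Γ_α`: `δ`-type with coefficient `α` at `v`, and the given
self-adjoint conditions at all other vertices. -/
def VertexConditions (v : V) (bc : ∀ u : V, u ≠ v → SelfAdjointCondition (Γ.Star u))
    (α : WithTop ℝ) (f : Γ.Fun) : Prop :=
  DeltaCondition f v α ∧
  ∀ (u : V) (hu : u ≠ v),
    (bc u hu).A.mulVec (vertexVal f u) + (bc u hu).B.mulVec (vertexDeriv f u) = 0

/-- `f` is in the domain of the Hamiltonian `-d²/dx² + W` of `Γ_α` (it is in `H²` on every edge and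
satisfies the vertex conditions) and the Hamiltonian maps `f` to `w` (a.e. on every edge). -/
def HamiltonianMaps (W : E → ℝ → ℝ) (v : V)
    (bc : ∀ u : V, u ≠ v → SelfAdjointCondition (Γ.Star u)) (α : WithTop ℝ)
    (f w : Γ.Fun) : Prop :=
  VertexConditions v bc α f ∧
  ∀ e, ∃ g : ℝ → ℂ, HasSecondDeriv f e g ∧
    ∀ᵐ x ∂volume.restrict (Ioc 0 (Γ.len e)),
      onEdge w e x = -g x + (W e x : ℂ) * onEdge f e x

theorem DeltaCondition.add {f g : Γ.Fun} {v : V} {α : WithTop ℝ}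
    (hd : vertexDeriv (f + g) v = vertexDeriv f v + vertexDeriv g v)
    (hf : DeltaCondition f v α) (hg : DeltaCondition g v α) : DeltaCondition (f + g) v α := by
  refine ⟨fun b b' => ?_, ?_⟩
  · simp only [vertexVal_add, Pi.add_apply]
    rw [hf.1 b b', hg.1 b b']
  · rcases α with _ | a
    · intro b
      have h1 := hf.2 b
      have h2 := hg.2 b
      simp [vertexVal_add, h1, h2]
    · intro b
      have h1 := hf.2 b
      have h2 := hg.2 b
      simp only [hd, vertexVal_add, Pi.add_apply, Finset.sum_add_distrib]
      rw [h1, h2]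
      ring

theorem DeltaCondition.smul (c : ℂ) {f : Γ.Fun} {v : V} {α : WithTop ℝ}
    (hd : vertexDeriv (c • f) v = c • vertexDeriv f v)
    (hf : DeltaCondition f v α) : DeltaCondition (c • f) v α := by
  refine ⟨fun b b' => ?_, ?_⟩
  · simp only [vertexVal_smul, Pi.smul_apply]
    rw [hf.1 b b']
  · rcases α with _ | a
    · intro b
      have h1 := hf.2 b
      simp [vertexVal_smul, h1]
    · intro b
      have h1 := hf.2 b
      simp only [hd, vertexVal_smul, Pi.smul_apply, smul_eq_mul, ← Finset.mul_sum]
      rw [h1]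
      ring

theorem HamiltonianMaps.differentiableOn {W : E → ℝ → ℝ} {v : V}
    {bc : ∀ u : V, u ≠ v → SelfAdjointCondition (Γ.Star u)} {α : WithTop ℝ} {f w : Γ.Fun}
    (h : HamiltonianMaps W v bc α f w) (e : E) :
    DifferentiableOn ℝ (onEdge f e) (Icc 0 (Γ.len e)) := by
  obtain ⟨g, hg, -⟩ := h.2 e
  exact hg.1

theorem HamiltonianMaps.add {W : E → ℝ → ℝ} {v : V}
    {bc : ∀ u : V, u ≠ v → SelfAdjointCondition (Γ.Star u)} {α : WithTop ℝ} {f w f' w' : Γ.Fun}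
    (h : HamiltonianMaps W v bc α f w) (h' : HamiltonianMaps W v bc α f' w') :
    HamiltonianMaps W v bc α (f + f') (w + w') := by
  have hd := vertexDeriv_add h.differentiableOn h'.differentiableOn
  refine ⟨⟨h.1.1.add (hd v) h'.1.1, fun u hu => ?_⟩, fun e => ?_⟩
  · rw [hd, vertexVal_add, Matrix.mulVec_add, Matrix.mulVec_add, add_add_add_comm,
      h.1.2 u hu, h'.1.2 u hu, add_zero]
  · obtain ⟨g, hg, hw⟩ := h.2 e
    obtain ⟨g', hg', hw'⟩ := h'.2 e
    refine ⟨g + g', hg.add hg', ?_⟩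
    filter_upwards [hw, hw'] with x h1 h2
    simp only [onEdge_add, Pi.add_apply, h1, h2]
    ring

theorem HamiltonianMaps.smul (c : ℂ) {W : E → ℝ → ℝ} {v : V}
    {bc : ∀ u : V, u ≠ v → SelfAdjointCondition (Γ.Star u)} {α : WithTop ℝ} {f w : Γ.Fun}
    (h : HamiltonianMaps W v bc α f w) :
    HamiltonianMaps W v bc α (c • f) (c • w) := by
  have hd := vertexDeriv_smul c h.differentiableOn
  refine ⟨⟨h.1.1.smul c (hd v), fun u hu => ?_⟩, fun e => ?_⟩
  · rw [hd, vertexVal_smul, Matrix.mulVec_smul, Matrix.mulVec_smul, ← smul_add,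
      h.1.2 u hu, smul_zero]
  · obtain ⟨g, hg, hw⟩ := h.2 e
    refine ⟨c • g, hg.smul c, ?_⟩
    filter_upwards [hw] with x h1
    simp only [onEdge_smul, Pi.smul_apply, smul_eq_mul, h1]
    ring

theorem HamiltonianMaps.zero (W : E → ℝ → ℝ) (v : V)
    (bc : ∀ u : V, u ≠ v → SelfAdjointCondition (Γ.Star u)) (α : WithTop ℝ) :
    HamiltonianMaps W v bc α (0 : Γ.Fun) 0 := by
  have h0 : ∀ e, onEdge (0 : Γ.Fun) e = 0 := fun _ => rfl
  have h1 : ∀ e, edgeDeriv (0 : Γ.Fun) e = 0 := by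
    intro e
    funext x
    simp [edgeDeriv, h0]
  have h2 : ∀ u, vertexVal (0 : Γ.Fun) u = 0 := fun _ => rfl
  have h3 : ∀ u, vertexDeriv (0 : Γ.Fun) u = 0 := by
    intro u
    funext b
    simp [vertexDeriv, endDeriv, h1]
  refine ⟨⟨⟨fun b b' => by simp [h2], ?_⟩, fun u hu => by simp [h2, h3]⟩, fun e => ?_⟩
  · rcases α with _ | a
    · intro b
      simp [h2]
    · intro b
      simp [h2, h3]
  · refine ⟨0, ⟨?_, MemLp.zero, fun x _ => by simp [h1]⟩, ?_⟩
    · rw [h0]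
      exact differentiableOn_const 0
    · simp [h0]

/-- The eigenspace `{f ∈ D(H) : H f = μ f}` of the Hamiltonian `H = -d²/dx² + W` of `Γ_α`. -/
def eigenspace (W : E → ℝ → ℝ) (v : V)
    (bc : ∀ u : V, u ≠ v → SelfAdjointCondition (Γ.Star u)) (α : WithTop ℝ) (μ : ℂ) :
    Submodule ℂ Γ.Fun where
  carrier := {f | HamiltonianMaps W v bc α f (μ • f)}
  zero_mem' := by
    simpa using HamiltonianMaps.zero W v bc α
  add_mem' := by
    intro f g hf hg
    simpa [smul_add] using HamiltonianMaps.add hf hg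
  smul_mem' := by
    intro c f hf
    simpa [smul_comm c μ f] using HamiltonianMaps.smul c hf

/-- `lam 0 ≤ lam 1 ≤ …` is the list of all eigenvalues of the Hamiltonian of `Γ_α`, each repeated
according to its multiplicity. -/
def IsEigenvalueSequence (W : E → ℝ → ℝ) (v : V)
    (bc : ∀ u : V, u ≠ v → SelfAdjointCondition (Γ.Star u)) (α : WithTop ℝ)
    (lam : ℕ → ℝ) : Prop :=
  Monotone lam ∧
  ∀ μ : ℂ, {n : ℕ | (lam n : ℂ) = μ}.encard
    = Cardinal.toENat (Module.rank ℂ (eigenspace W v bc α μ))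

end MetricGraph

/-!
For large `κ` the resolvent `(H_α + κ)⁻¹` is compact and positive, and its eigenvalues are the
numbers `1 / (λ_n + κ)`. Raising `α` raises the quadratic form `⟨(H_α + κ) f, f⟩` and shrinks its
domain, hence lowers the resolvent; by min-max this is `λ_n(Γ_α) ≤ λ_n(Γ_α')`. The resolvents of
`Γ_α` and `Γ_α'` agree on those `g` for which `(H_α + κ)⁻¹ g` vanishes at `v`, a hyperplane at
worst, so min-max loses one index in the other direction. Finally, Green's formula for
eigenfunctions `f` of `Γ_α'` and `h` of `Γ_α` with a common eigenvalue gives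
`(∑ f'(v) - α f(v)) conj (h(v)) = 0`. Unless `f` and `∑ f'` both vanish at `v`, the
first factor is nonzero, so `h(v) = 0` and `h` is an eigenfunction of `Γ_α'` as well; if the
eigenvalue of `Γ_α'` is simple, `h` is a multiple of `f`, hence zero. So a simple eigenvalue of
`Γ_α'` with such an `f` is not an eigenvalue of `Γ_α`, and the inequalities are strict.
-/

section CompactOperators

open Module End

theorem exists_equiv_nat_monotone {ι α : Type*} [Infinite ι] [LinearOrder α] {f : ι → α}
    (hf : ∀ t, {i | f i ≤ t}.Finite) : ∃ σ : ℕ ≃ ι, Monotone (f ∘ σ) := by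
  -- Ties of `f` are broken by an arbitrary injection into a linear order.
  let key : ι → α ×ₗ Cardinal := fun i => toLex (f i, embeddingToCardinal i)
  have key_injective : Function.Injective key := fun i j h =>
    embeddingToCardinal.injective (congrArg (fun p => (ofLex p).2) h)
  let _ : LinearOrder ι := LinearOrder.lift' key key_injective
  have f_mono : Monotone f := fun i j h =>
    (Prod.Lex.toLex_le_toLex.1 (show key i ≤ key j from h)).elim le_of_lt fun h => h.1.le
  have finite_Iic (i : ι) : (Iic i).Finite := (hf (f i)).subset fun j hj => f_mono hj
  have : NoMaxOrder ι := ⟨fun i => (finite_Iic i).infinite_compl.nonempty.imp fun _ => not_le.1⟩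
  let _ : LocallyFiniteOrder ι := .ofFiniteIcc fun i j => (finite_Iic j).subset Icc_subset_Iic_self
  let a : ι := Classical.arbitrary ι
  obtain ⟨i₀, hi₀⟩ := (finite_Iic a).exists_minimal ⟨a, self_mem_Iic⟩
  let _ : OrderBot ι :=
    { bot := i₀
      bot_le := fun j => (le_total i₀ j).elim id fun h => hi₀.2 (h.trans hi₀.1) h }
  let _ := LinearLocallyFiniteOrder.succOrder ι
  let _ := LinearLocallyFiniteOrder.predOrder ι
  let σ : ι ≃o ℕ := orderIsoNatOfLinearSuccPredArch
  exact ⟨σ.symm.toEquiv, f_mono.comp σ.symm.monotone⟩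

variable {𝕜 H : Type*} [RCLike 𝕜] [NormedAddCommGroup H] [InnerProductSpace 𝕜 H] {T T' : H →L[𝕜] H}

theorem exists_hilbertBasis_of_card_fiber_eq_finrank [CompleteSpace H] {ι : Type*}
    (hT : IsCompactOperator T) (hs : T.IsSymmetric) {τ : ι → 𝕜}
    (hfin : ∀ s, FiniteDimensional 𝕜 (eigenspace (T : End 𝕜 H) s))
    (hfib : ∀ s, Finite {i // τ i = s})
    (hcard : ∀ s, Nat.card {i // τ i = s} = finrank 𝕜 (eigenspace (T : End 𝕜 H) s)) :
    ∃ b : HilbertBasis ι 𝕜 H, ∀ i, T (b i) = τ i • b i := by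
  classical
  have (s : 𝕜) : Fintype {i // τ i = s} := Fintype.ofFinite _
  let eigenbasis (s : 𝕜) : OrthonormalBasis {i // τ i = s} 𝕜 (eigenspace (T : End 𝕜 H) s) :=
    (stdOrthonormalBasis 𝕜 _).reindex
      (Fintype.equivOfCardEq (by rw [Fintype.card_fin, ← hcard s, Nat.card_eq_fintype_card]))
  let w (i : ι) : H := eigenbasis (τ i) ⟨i, rfl⟩
  have w_orthonormal : Orthonormal 𝕜 w :=
    (hs.orthogonalFamily_eigenspaces.orthonormal_sigma_orthonormal
      fun s => (eigenbasis s).orthonormal).comp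
        (fun i : ι => (⟨τ i, ⟨i, rfl⟩⟩ : Σ s, {i // τ i = s}))
        fun _ _ h => congrArg (fun q : Σ s, {i // τ i = s} => q.2.1) h
  have eigenspace_le (s : 𝕜) :
      eigenspace (T : End 𝕜 H) s ≤ Submodule.span 𝕜 (range w) := by
    have h : Submodule.map (eigenspace (T : End 𝕜 H) s).subtype
        (Submodule.span 𝕜 (range (eigenbasis s).toBasis)) ≤ Submodule.span 𝕜 (range w) := by
      rw [Submodule.map_span, Submodule.span_le, OrthonormalBasis.coe_toBasis]
      rintro _ ⟨_, ⟨⟨i, rfl⟩, rfl⟩, rfl⟩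
      exact Submodule.subset_span ⟨i, rfl⟩
    rwa [Basis.span_eq, Submodule.map_top, Submodule.range_subtype] at h
  have w_total : (Submodule.span 𝕜 (range w))ᗮ = ⊥ := by
    rw [eq_bot_iff, ← ContinuousLinearMap.orthogonalComplement_iSup_eigenspaces_eq_bot hT hs]
    exact Submodule.orthogonal_le (iSup_le eigenspace_le)
  refine ⟨HilbertBasis.mkOfOrthogonalEqBot w_orthonormal w_total, fun i => ?_⟩
  rw [HilbertBasis.coe_mkOfOrthogonalEqBot]
  exact mem_eigenspace_iff.1 (eigenbasis (τ i) ⟨i, rfl⟩).2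

theorem finite_setOf_le_norm_eigenvalue {ι : Type*} (hT : IsCompactOperator T) {b : ι → H}
    (hb : Orthonormal 𝕜 b) {τ : ι → 𝕜} (hτ : ∀ i, T (b i) = τ i • b i) {t : ℝ} (ht : 0 < t) :
    {i | t ≤ ‖τ i‖}.Finite := by
  by_contra hinf
  let g := Set.Infinite.natEmbedding _ hinf
  have separated {m n : ℕ} (hmn : m ≠ n) : t ≤ dist (T (b (g m))) (T (b (g n))) := by
    have hne : (g m : ι) ≠ g n := fun h => hmn (g.injective (Subtype.ext h))
    have pythagoras : ‖T (b (g m)) - T (b (g n))‖ ^ 2 = ‖τ (g m)‖ ^ 2 + ‖τ (g n)‖ ^ 2 := by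
      rw [@norm_sub_sq 𝕜, hτ, hτ, inner_smul_left, inner_smul_right, hb.2 hne]
      simp [norm_smul, hb.1]
    rw [dist_eq_norm]
    refine (pow_le_pow_iff_left₀ ht.le (norm_nonneg _) two_ne_zero).1 ?_
    rw [pythagoras]
    exact (pow_le_pow_left₀ ht.le (g m).2 2).trans (le_add_of_nonneg_right (sq_nonneg _))
  obtain ⟨K, hK, hTK⟩ := hT.image_closedBall_subset_compact (𝕜₁ := 𝕜) (f := (T : H →ₗ[𝕜] H)) 1
  obtain ⟨y, -, ψ, hψ, hψy⟩ := hK.tendsto_subseq (x := fun n => T (b (g n)))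
    (fun n => hTK ⟨b (g n), by simp [hb.1], rfl⟩)
  obtain ⟨N, hN⟩ := Metric.cauchySeq_iff'.1 hψy.cauchySeq t ht
  exact (hN (N + 1) N.le_succ).not_ge (separated (hψ N.lt_succ_self).ne')

/-- A compact symmetric operator whose quadratic form is positive definite. -/
structure IsCompactPosDef (T : H →L[𝕜] H) : Prop where
  isCompactOperator : IsCompactOperator T
  isSymmetric : T.IsSymmetric
  re_inner_pos : ∀ x, x ≠ 0 → 0 < RCLike.re (inner 𝕜 (T x) x)

/-- The eigenvalues of `T` in non-increasing order, each repeated according to its multiplicity. -/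
structure IsEigenvalueList (T : H →L[𝕜] H) (τ : ℕ → ℝ) : Prop where
  antitone : Antitone τ
  encard_eq : ∀ s : 𝕜, {n | (τ n : 𝕜) = s}.encard
    = Cardinal.toENat (Module.rank 𝕜 (eigenspace (T : End 𝕜 H) s))

namespace IsCompactPosDef

theorem eigenvalue_eq_ofReal (hT : IsCompactPosDef T) {s : 𝕜} {x : H} (hx : x ≠ 0)
    (h : T x = s • x) : 0 < RCLike.re s ∧ (RCLike.re s : 𝕜) = s := by
  have conj_eq : (starRingEnd 𝕜) s = s := hT.isSymmetric.conj_eigenvalue_eq_self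
    (hasEigenvalue_of_hasEigenvector ⟨mem_eigenspace_iff.2 h, hx⟩)
  have real := RCLike.conj_eq_iff_re.1 conj_eq
  refine ⟨?_, real⟩
  have form_pos := hT.re_inner_pos x hx
  rw [h, inner_smul_left, conj_eq, inner_self_eq_norm_sq_to_K, ← real, ← RCLike.ofReal_pow,
    RCLike.re_ofReal_mul, RCLike.ofReal_re] at form_pos
  exact pos_of_mul_pos_left form_pos (sq_nonneg _)

theorem finiteDimensional_eigenspace [CompleteSpace H] (hT : IsCompactPosDef T) (s : 𝕜) :
    FiniteDimensional 𝕜 (eigenspace (T : End 𝕜 H) s) := by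
  rcases eq_or_ne s 0 with rfl | hs
  · have : eigenspace (T : End 𝕜 H) 0 = ⊥ := (Submodule.eq_bot_iff _).2 fun x hx => by
      by_contra hne
      simpa using (hT.eigenvalue_eq_ofReal hne (mem_eigenspace_iff.1 hx)).1
    rw [this]
    infer_instance
  · exact ContinuousLinearMap.finite_dimensional_eigenspace hT.isCompactOperator s hs

theorem exists_isEigenvalueList [CompleteSpace H] (hT : IsCompactPosDef T)
    (hH : ¬ FiniteDimensional 𝕜 H) : ∃ τ, IsEigenvalueList T τ ∧ ∀ n, 0 < τ n := by
  have hfin := hT.finiteDimensional_eigenspace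
  let I := Σ s : 𝕜, Fin (finrank 𝕜 (eigenspace (T : End 𝕜 H) s))
  let fiber (s : 𝕜) : {i : I // i.1 = s} ≃ Fin (finrank 𝕜 (eigenspace (T : End 𝕜 H) s)) :=
    Equiv.sigmaSubtype s
  have hfib (s : 𝕜) : Finite {i : I // i.1 = s} := .of_equiv _ (fiber s).symm
  have hcard (s : 𝕜) : Nat.card {i : I // i.1 = s} = finrank 𝕜 (eigenspace (T : End 𝕜 H) s) := by
    rw [Nat.card_congr (fiber s), Nat.card_fin]
  obtain ⟨b, hb⟩ := exists_hilbertBasis_of_card_fiber_eq_finrank hT.isCompactOperator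
    hT.isSymmetric hfin hfib hcard
  have pos_real (i : I) : 0 < RCLike.re i.1 ∧ (RCLike.re i.1 : 𝕜) = i.1 :=
    hT.eigenvalue_eq_ofReal (b.orthonormal.ne_zero i) (hb i)
  have infinite : Infinite I := by
    refine not_finite_iff_infinite.1 fun _ => hH ?_
    have := Fintype.ofFinite I
    exact (b.toOrthonormalBasis).toBasis.finiteDimensional_of_finite
  obtain ⟨σ, hσ⟩ := exists_equiv_nat_monotone (f := fun i : I => (RCLike.re i.1)⁻¹) fun t => by
    refine (finite_setOf_le_norm_eigenvalue hT.isCompactOperator b.orthonormal hb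
      (t := (max t 1)⁻¹) (by positivity)).subset fun i hi => ?_
    rw [mem_ofPred_eq, ← (pos_real i).2, RCLike.norm_of_nonneg (pos_real i).1.le]
    exact inv_le_of_inv_le₀ (pos_real i).1 (le_max_of_le_left hi)
  refine ⟨fun n => RCLike.re (σ n).1, ⟨fun m n hmn => ?_, fun s => ?_⟩, fun n => (pos_real _).1⟩
  · exact (inv_le_inv₀ (pos_real _).1 (pos_real _).1).1 (hσ hmn)
  · have preimage : {n : ℕ | (RCLike.re (σ n).1 : 𝕜) = s} = σ ⁻¹' {i : I | i.1 = s} := by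
      simp only [(pos_real _).2, preimage_ofPred_eq]
    have : Finite {i : I | i.1 = s} := hfib s
    have card : Nat.card {i : I | i.1 = s} = _ := hcard s
    rw [preimage, encard_preimage_of_bijective σ.bijective, ← finrank_eq_rank,
      encard, ENat.card_eq_coe_natCard, card, Cardinal.toENat_nat]

theorem exists_hilbertBasis [CompleteSpace H] (hT : IsCompactPosDef T) {τ : ℕ → ℝ}
    (hτ : IsEigenvalueList T τ) : ∃ b : HilbertBasis ℕ 𝕜 H, ∀ n, T (b n) = (τ n : 𝕜) • b n := by
  have hfin := hT.finiteDimensional_eigenspace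
  have encard_eq (s : 𝕜) :
      {n | (τ n : 𝕜) = s}.encard = finrank 𝕜 (eigenspace (T : End 𝕜 H) s) := by
    rw [hτ.encard_eq s, ← finrank_eq_rank, Cardinal.toENat_nat]
  have hfib (s : 𝕜) : {n | (τ n : 𝕜) = s}.Finite := by
    rw [← encard_ne_top_iff, encard_eq s]
    exact ENat.natCast_ne_top _
  refine exists_hilbertBasis_of_card_fiber_eq_finrank hT.isCompactOperator hT.isSymmetric hfin
    (fun s => (hfib s).to_subtype) fun s => ?_
  have ncard_eq := encard_eq s
  rw [← (hfib s).cast_ncard_eq] at ncard_eq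
  exact_mod_cast ncard_eq

end IsCompactPosDef

theorem re_inner_le_of_inner_eq_zero (hs : T.IsSymmetric) {b : HilbertBasis ℕ 𝕜 H} {τ : ℕ → ℝ}
    (hb : ∀ n, T (b n) = (τ n : 𝕜) • b n) (hτ : Antitone τ) {n : ℕ} {g : H}
    (hg : ∀ i < n, inner 𝕜 (b i) g = 0) : RCLike.re (inner 𝕜 (T g) g) ≤ τ n * ‖g‖ ^ 2 := by
  have conj_mul_self (i : ℕ) :
      inner 𝕜 g (b i) * inner 𝕜 (b i) g = ((‖inner 𝕜 (b i) g‖ ^ 2 : ℝ) : 𝕜) := by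
    rw [← inner_conj_symm, RCLike.conj_mul, RCLike.ofReal_pow]
  have form_eq : HasSum (fun i => τ i * ‖inner 𝕜 (b i) g‖ ^ 2) (RCLike.re (inner 𝕜 (T g) g)) := by
    have summand (i : ℕ) : inner 𝕜 (T g) (b i) * inner 𝕜 (b i) g
        = ((τ i * ‖inner 𝕜 (b i) g‖ ^ 2 : ℝ) : 𝕜) := by
      rw [hs.apply_clm, hb, inner_smul_right, mul_assoc, conj_mul_self, RCLike.ofReal_mul]
    simpa only [summand, RCLike.ofReal_re] using
      RCLike.hasSum_re 𝕜 (b.hasSum_inner_mul_inner (T g) g)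
  have parseval : HasSum (fun i => ‖inner 𝕜 (b i) g‖ ^ 2) (‖g‖ ^ 2) := by
    simpa only [conj_mul_self, RCLike.ofReal_re, inner_self_eq_norm_sq] using
      RCLike.hasSum_re 𝕜 (b.hasSum_inner_mul_inner g g)
  refine hasSum_le (fun i => ?_) form_eq (parseval.mul_left (τ n))
  rcases lt_or_ge i n with hi | hi
  · simp [hg i hi]
  · exact mul_le_mul_of_nonneg_right (hτ hi) (sq_nonneg _)

theorem mul_norm_sq_le_re_inner_sum {b : ℕ → H} {τ : ℕ → ℝ} (ho : Orthonormal 𝕜 b)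
    (hb : ∀ n, T (b n) = (τ n : 𝕜) • b n) (hτ : Antitone τ) {n : ℕ} (c : Fin (n + 1) → 𝕜) :
    τ n * ‖∑ i, c i • b i‖ ^ 2 ≤ RCLike.re (inner 𝕜 (T (∑ i, c i • b i)) (∑ i, c i • b i)) := by
  have ho' : Orthonormal 𝕜 (fun i : Fin (n + 1) => b i) := ho.comp _ Fin.val_injective
  have map_eq : T (∑ i, c i • b i) = ∑ i : Fin (n + 1), (τ i * c i) • b i := by
    simp only [map_sum, map_smul, hb, smul_smul, mul_comm]
  have form_eq : RCLike.re (inner 𝕜 (T (∑ i, c i • b i)) (∑ i, c i • b i))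
      = ∑ i : Fin (n + 1), τ i * ‖c i‖ ^ 2 := by
    rw [map_eq, ho'.inner_sum, map_sum]
    refine Finset.sum_congr rfl fun i _ => ?_
    rw [map_mul (starRingEnd 𝕜), RCLike.conj_ofReal, mul_assoc, RCLike.conj_mul,
      ← RCLike.ofReal_pow, RCLike.re_ofReal_mul, RCLike.ofReal_re]
  have norm_sq_eq : ‖∑ i, c i • b i‖ ^ 2 = ∑ i : Fin (n + 1), ‖c i‖ ^ 2 := by
    rw [← inner_self_eq_norm_sq (𝕜 := 𝕜), ho'.inner_sum, map_sum]
    simp only [RCLike.conj_mul, ← RCLike.ofReal_pow, RCLike.ofReal_re]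
  rw [form_eq, norm_sq_eq, Finset.mul_sum]
  exact Finset.sum_le_sum fun i _ =>
    mul_le_mul_of_nonneg_right (hτ (Nat.lt_succ_iff.1 i.2)) (sq_nonneg _)

theorem IsEigenvalueList.le_of_re_inner_le [CompleteSpace H] (hT : IsCompactPosDef T)
    (hT' : IsCompactPosDef T') {τ τ' : ℕ → ℝ} (hτ : IsEigenvalueList T τ)
    (hτ' : IsEigenvalueList T' τ') {m : ℕ} (φ : H →ₗ[𝕜] (Fin m → 𝕜))
    (h : ∀ g, φ g = 0 → RCLike.re (inner 𝕜 (T' g) g) ≤ RCLike.re (inner 𝕜 (T g) g)) (n : ℕ) :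
    τ' (n + m) ≤ τ n := by
  obtain ⟨b, hb⟩ := hT.exists_hilbertBasis hτ
  obtain ⟨b', hb'⟩ := hT'.exists_hilbertBasis hτ'
  let comb : (Fin (n + m + 1) → 𝕜) →ₗ[𝕜] H := Fintype.linearCombination 𝕜 fun i => b' i
  let coord : H →ₗ[𝕜] (Fin n → 𝕜) := LinearMap.pi fun i => (innerSL 𝕜 (b i) : H →ₗ[𝕜] 𝕜)
  have ker_ne_bot : ((coord.prod φ).comp comb).ker ≠ ⊥ :=
    LinearMap.ker_ne_bot_of_finrank_lt (by simp)
  obtain ⟨c, hc, c_ne⟩ := Submodule.exists_mem_ne_zero_of_ne_bot ker_ne_bot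
  have coord_eq : coord (comb c) = 0 := congrArg Prod.fst hc
  have φ_eq : φ (comb c) = 0 := congrArg Prod.snd hc
  have hcomb : comb c = ∑ i, c i • b' i := Fintype.linearCombination_apply ..
  have comb_ne : comb c ≠ 0 := fun h0 => c_ne <| funext <|
    Fintype.linearIndependent_iff.1
      (b'.orthonormal.comp _ Fin.val_injective).linearIndependent c (hcomb ▸ h0)
  refine le_of_mul_le_mul_right ?_ (show 0 < ‖comb c‖ ^ 2 by positivity)
  calc τ' (n + m) * ‖comb c‖ ^ 2
      ≤ RCLike.re (inner 𝕜 (T' (comb c)) (comb c)) :=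
        hcomb ▸ mul_norm_sq_le_re_inner_sum b'.orthonormal hb' hτ'.antitone c
    _ ≤ RCLike.re (inner 𝕜 (T (comb c)) (comb c)) := h _ φ_eq
    _ ≤ τ n * ‖comb c‖ ^ 2 := re_inner_le_of_inner_eq_zero hT.isSymmetric hb hτ.antitone
        fun i hi => congrFun coord_eq ⟨i, hi⟩

end CompactOperators

section IntervalSpaces

open scoped BoundedContinuousFunction ComplexConjugate

theorem absolutelyContinuousOnInterval_of_dist_le {X Y : Type*} [PseudoMetricSpace X]
    [PseudoMetricSpace Y] {f : ℝ → X} {g : ℝ → Y} {a b : ℝ}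
    (hg : AbsolutelyContinuousOnInterval g a b)
    (h : ∀ x ∈ uIcc a b, ∀ y ∈ uIcc a b, dist (f x) (f y) ≤ dist (g x) (g y)) :
    AbsolutelyContinuousOnInterval f a b := by
  rw [absolutelyContinuousOnInterval_iff] at hg ⊢
  intro ε hε
  obtain ⟨δ, hδ, hsum⟩ := hg ε hε
  exact ⟨δ, hδ, fun I hI hlt =>
    (Finset.sum_le_sum fun i hi => h _ (hI.1 i hi).1 _ (hI.1 i hi).2).trans_lt (hsum I hI hlt)⟩

theorem absolutelyContinuousOnInterval_intervalIntegral {F : Type*} [NormedAddCommGroup F]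
    [NormedSpace ℝ F] {g : ℝ → F} {a b : ℝ} (hg : IntervalIntegrable g volume a b) :
    AbsolutelyContinuousOnInterval (fun x => ∫ t in a..x, g t) a b := by
  refine absolutelyContinuousOnInterval_of_dist_le
    (hg.norm.absolutelyContinuousOnInterval_intervalIntegral left_mem_uIcc) fun x hx y hy => ?_
  have hgx := hg.mono_set (uIcc_subset_uIcc_left hx)
  have hgy := hg.mono_set (uIcc_subset_uIcc_left hy)
  rw [dist_eq_norm, Real.dist_eq, intervalIntegral.integral_interval_sub_left hgx hgy,
    intervalIntegral.integral_interval_sub_left hgx.norm hgy.norm]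
  exact intervalIntegral.norm_integral_le_abs_integral_norm

theorem integral_mul_add_mul_eq_sub {𝕜 : Type*} [RCLike 𝕜] {p q g h : ℝ → 𝕜} {a b : ℝ} (hab : a ≤ b)
    (hg : IntervalIntegrable g volume a b) (hh : IntervalIntegrable h volume a b)
    (hp : ∀ x ∈ Icc a b, p x = p a + ∫ t in a..x, g t)
    (hq : ∀ x ∈ Icc a b, q x = q a + ∫ t in a..x, h t) :
    ∫ x in a..b, (g x * q x + p x * h x) = p b * q b - p a * q a := by
  have ac_const (z : 𝕜) : AbsolutelyContinuousOnInterval (fun _ : ℝ => z) a b :=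
    (LipschitzWith.const z).lipschitzOnWith.absolutelyContinuousOnInterval
  let P : ℝ → 𝕜 := fun x => p a + ∫ t in a..x, g t
  let Q : ℝ → 𝕜 := fun x => q a + ∫ t in a..x, h t
  have hP : AbsolutelyContinuousOnInterval P a b :=
    (ac_const (p a)).add (absolutelyContinuousOnInterval_intervalIntegral hg)
  have hQ : AbsolutelyContinuousOnInterval Q a b :=
    (ac_const (q a)).add (absolutelyContinuousOnInterval_intervalIntegral hh)
  have hint : IntervalIntegrable (fun x => g x * Q x + P x * h x) volume a b :=
    (hg.mul_continuousOn hQ.continuousOn).add (hh.continuousOn_mul hP.continuousOn)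
  obtain ⟨C, hC⟩ := ((hP.smul hQ).sub
      (absolutelyContinuousOnInterval_intervalIntegral hint)).const_of_ae_hasDerivAt_zero (by
    filter_upwards [hg.ae_hasDerivAt_integral, hh.ae_hasDerivAt_integral,
      hint.ae_hasDerivAt_integral] with x hgx hhx hintx hx
    exact ((((hgx hx a left_mem_uIcc).const_add (p a)).mul
      ((hhx hx a left_mem_uIcc).const_add (q a))).sub (hintx hx a left_mem_uIcc)).congr_deriv
        (sub_self _))
  have hCa : p a * q a = C := by simpa [P, Q] using hC a left_mem_uIcc
  have hCb : p b * q b - ∫ x in a..b, (g x * Q x + P x * h x) = C := by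
    simpa [P, Q, ← hp b ⟨hab, le_rfl⟩, ← hq b ⟨hab, le_rfl⟩] using hC b right_mem_uIcc
  have hcongr : ∫ x in a..b, (g x * Q x + P x * h x) = ∫ x in a..b, (g x * q x + p x * h x) := by
    refine intervalIntegral.integral_congr fun x hx => ?_
    rw [uIcc_of_le hab] at hx
    rw [hp x hx, hq x hx]
  rw [← hcongr, hCa, ← hCb, sub_sub_cancel]

/-- The space `L²(0, L)`. -/
abbrev IntervalL2 (L : ℝ) : Type := Lp ℂ 2 (volume.restrict (Ioc (0 : ℝ) L))

/-- Continuous functions on `[0, L]` with the supremum norm. -/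
abbrev IntervalC (L : ℝ) : Type := Icc (0 : ℝ) L →ᵇ ℂ

variable {L : ℝ}

theorem intervalIntegrable_of_mem_Icc (g : IntervalL2 L) {x y : ℝ} (hx : x ∈ Icc 0 L)
    (hy : y ∈ Icc 0 L) : IntervalIntegrable g volume x y := by
  have hg : IntegrableOn g (Ioc 0 L) := (Lp.memLp g).integrable (by norm_num)
  exact intervalIntegrable_iff.2 (hg.mono_set (Ioc_subset_Ioc (le_min hx.1 hy.1)
    (max_le hx.2 hy.2)))

theorem norm_integral_le_sqrt_mul (g : IntervalL2 L) {x y : ℝ} (hx : x ∈ Icc 0 L)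
    (hy : y ∈ Icc 0 L) : ‖∫ t in x..y, g t‖ ≤ √|y - x| * ‖g‖ := by
  wlog hxy : x ≤ y generalizing x y
  · rw [intervalIntegral.integral_symm, norm_neg, abs_sub_comm]
    exact this hy hx (le_of_not_ge hxy)
  have hsub : Ioc x y ⊆ Ioc 0 L := Ioc_subset_Ioc hx.1 hy.2
  have hfin : (volume.restrict (Ioc 0 L)) (Ioc x y) ≠ ⊤ := by
    rw [Measure.restrict_apply measurableSet_Ioc, inter_eq_left.2 hsub]
    exact measure_Ioc_lt_top.ne
  have hmeas : (volume.restrict (Ioc 0 L)).real (Ioc x y) = y - x := by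
    rw [measureReal_restrict_apply measurableSet_Ioc, inter_eq_left.2 hsub,
      Real.volume_real_Ioc_of_le hxy]
  have hinner : ∫ t in x..y, g t
      = inner ℂ (indicatorConstLp 2 measurableSet_Ioc hfin (1 : ℂ)) g := by
    rw [L2.inner_indicatorConstLp_one, Measure.restrict_restrict measurableSet_Ioc,
      inter_eq_left.2 hsub, intervalIntegral.integral_of_le hxy]
  have hnorm : ‖indicatorConstLp 2 measurableSet_Ioc hfin (1 : ℂ)‖ = √|y - x| := by
    rw [norm_indicatorConstLp (by norm_num) (by norm_num), hmeas,
      abs_of_nonneg (sub_nonneg.2 hxy), Real.sqrt_eq_rpow]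
    simp
  rw [hinner, ← hnorm]
  exact norm_inner_le_norm _ _

theorem norm_integral_sub_le (g : IntervalL2 L) {x y : ℝ} (hx : x ∈ Icc 0 L) (hy : y ∈ Icc 0 L) :
    ‖(∫ t in 0..y, g t) - ∫ t in 0..x, g t‖ ≤ √|y - x| * ‖g‖ := by
  have h0 : (0 : ℝ) ∈ Icc 0 L := ⟨le_rfl, hx.1.trans hx.2⟩
  rw [intervalIntegral.integral_interval_sub_left (intervalIntegrable_of_mem_Icc g h0 hy)
    (intervalIntegrable_of_mem_Icc g h0 hx)]
  exact norm_integral_le_sqrt_mul g hx hy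

theorem integral_congr_ae_of_mem {g g' : ℝ → ℂ} (h : g =ᵐ[volume.restrict (Ioc 0 L)] g') {x : ℝ}
    (hx : x ∈ Icc 0 L) : ∫ t in 0..x, g t = ∫ t in 0..x, g' t := by
  rw [intervalIntegral.integral_of_le hx.1, intervalIntegral.integral_of_le hx.1]
  exact integral_congr_ae (ae_mono (Measure.restrict_mono (Ioc_subset_Ioc_right hx.2) le_rfl) h)

theorem continuous_integral_Icc (g : IntervalL2 L) :
    Continuous fun x : Icc (0 : ℝ) L => ∫ t in (0 : ℝ)..x, g t := by
  refine continuous_iff_continuousAt.2 fun x => tendsto_iff_norm_sub_tendsto_zero.2 ?_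
  refine squeeze_zero (fun _ => norm_nonneg _) (fun y => norm_integral_sub_le g x.2 y.2) ?_
  have : Continuous fun y : Icc (0 : ℝ) L => √|(y : ℝ) - x| * ‖g‖ := by fun_prop
  simpa using this.tendsto x

/-- The primitive `x ↦ ∫₀ˣ g` of a square integrable function, as a linear map. Its continuity is
part of `primitive` below. -/
noncomputable def primitiveₗ (L : ℝ) : IntervalL2 L →ₗ[ℂ] IntervalC L where
  toFun g := BoundedContinuousFunction.mkOfCompact ⟨_, continuous_integral_Icc g⟩
  map_add' g h := by
    ext x
    have h0 : (0 : ℝ) ∈ Icc 0 L := ⟨le_rfl, x.2.1.trans x.2.2⟩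
    exact (integral_congr_ae_of_mem (Lp.coeFn_add g h) x.2).trans
      (intervalIntegral.integral_add (intervalIntegrable_of_mem_Icc g h0 x.2)
        (intervalIntegrable_of_mem_Icc h h0 x.2))
  map_smul' c g := by
    ext x
    exact (integral_congr_ae_of_mem (Lp.coeFn_smul c g) x.2).trans
      (intervalIntegral.integral_smul c _)

theorem isCompactOperator_primitiveₗ (L : ℝ) : IsCompactOperator (primitiveₗ L) := by
  rw [isCompactOperator_iff_isCompact_closure_image_closedBall _ one_pos]
  refine BoundedContinuousFunction.arzela_ascoli (Metric.closedBall 0 (√|L|))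
    (isCompact_closedBall _ _) _ ?bounded ?equicontinuous
  case bounded =>
    rintro _ x ⟨g, hg, rfl⟩
    rw [mem_closedBall_zero_iff] at hg ⊢
    refine (norm_integral_le_sqrt_mul g ⟨le_rfl, x.2.1.trans x.2.2⟩ x.2).trans ?_
    rw [sub_zero, abs_of_nonneg x.2.1]
    exact (mul_le_of_le_one_right (Real.sqrt_nonneg _) hg).trans
      (Real.sqrt_le_sqrt (x.2.2.trans (le_abs_self L)))
  case equicontinuous =>
    refine Metric.equicontinuous_of_continuity_modulus (fun r => √|r|) ?_ _ ?_
    · have : Continuous fun r : ℝ => √|r| := by fun_prop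
      simpa using this.tendsto 0
    · rintro x y ⟨_, g, hg, rfl⟩
      rw [mem_closedBall_zero_iff] at hg
      rw [dist_eq_norm, Subtype.dist_eq, Real.dist_eq, abs_abs]
      exact (norm_integral_sub_le g y.2 x.2).trans (mul_le_of_le_one_right (Real.sqrt_nonneg _) hg)

/-- The compact operator `L²(0, L) → C[0, L]` of integration from `0`. -/
noncomputable def primitive (L : ℝ) : IntervalL2 L →L[ℂ] IntervalC L :=
  ContinuousLinearMap.mkOfIsCompactOperator (isCompactOperator_primitiveₗ L)

theorem isCompactOperator_primitive (L : ℝ) : IsCompactOperator (primitive L) :=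
  isCompactOperator_primitiveₗ L

theorem primitive_apply (g : IntervalL2 L) (x : Icc (0 : ℝ) L) :
    primitive L g x = ∫ t in (0 : ℝ)..x, g t := rfl

theorem primitive_injective (hL : 0 ≤ L) : Function.Injective (primitive L) := by
  refine (injective_iff_map_eq_zero _).2 fun g hg => ?_
  have hzero : ∀ x ∈ Icc 0 L, ∫ t in (0 : ℝ)..x, g t = 0 := fun x hx =>
    (primitive_apply g ⟨x, hx⟩).symm.trans (by rw [hg]; rfl)
  have hint := intervalIntegrable_of_mem_Icc g ⟨le_rfl, hL⟩ ⟨hL, le_rfl⟩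
  rw [Lp.eq_zero_iff_ae_eq_zero, Filter.EventuallyEq, ae_restrict_iff' measurableSet_Ioc]
  filter_upwards [hint.ae_hasDerivAt_integral, Measure.ae_ne volume L] with x hderiv hxL hx
  have hderiv := hderiv (uIcc_of_le hL ▸ Ioc_subset_Icc_self hx) 0 left_mem_uIcc
  have hlocal : (fun u => ∫ t in (0 : ℝ)..u, g t) =ᶠ[nhds x] fun _ => 0 := by
    filter_upwards [Icc_mem_nhds hx.1 (hx.2.lt_of_ne hxL)] with u hu using hzero u hu
  exact hderiv.unique ((hasDerivAt_const x (0 : ℂ)).congr_of_eventuallyEq hlocal)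

/-- The function on `[0, L]` with value `a` at `0` and derivative `p`. -/
noncomputable def affinePrimitive (a : ℂ) (p : IntervalL2 L) : IntervalC L :=
  BoundedContinuousFunction.const _ a + primitive L p

theorem affinePrimitive_apply (a : ℂ) (p : IntervalL2 L) (x : Icc (0 : ℝ) L) :
    affinePrimitive a p x = a + ∫ t in (0 : ℝ)..x, p t := rfl

variable (hL : 0 ≤ L)

theorem continuous_IccExtend (h : IntervalC L) : Continuous (IccExtend hL h) :=
  h.continuous.Icc_extend'

theorem memLp_mul_IccExtend {w : ℝ → ℂ} (hw : MemLp w 2 (volume.restrict (Ioc 0 L)))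
    (h : IntervalC L) :
    MemLp (fun x => w x * IccExtend hL h x) 2 (volume.restrict (Ioc 0 L)) := by
  refine hw.of_le_mul (c := ‖h‖) (hw.1.mul (continuous_IccExtend hL h).aestronglyMeasurable)
    (Filter.Eventually.of_forall fun x => ?_)
  rw [norm_mul, mul_comm]
  gcongr
  exact h.norm_coe_le_norm _

/-- Multiplication by a fixed square integrable function, from `C[0, L]` to `L²(0, L)`. -/
noncomputable def mulL2 (w : ℝ → ℂ) (hw : MemLp w 2 (volume.restrict (Ioc 0 L))) :
    IntervalC L →L[ℂ] IntervalL2 L :=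
  LinearMap.mkContinuous
    { toFun := fun h => (memLp_mul_IccExtend hL hw h).toLp
      map_add' := fun h k => by
        rw [← MemLp.toLp_add]
        exact MemLp.toLp_congr _ _ (Filter.Eventually.of_forall fun x => mul_add _ _ _)
      map_smul' := fun c h => by
        rw [RingHom.id_apply, ← MemLp.toLp_const_smul]
        exact MemLp.toLp_congr _ _ (Filter.Eventually.of_forall fun x => mul_left_comm _ _ _) }
    ‖hw.toLp‖ fun h => by
      rw [mul_comm]
      refine Lp.norm_le_mul_norm_of_ae_le_mul ?_
      filter_upwards [(memLp_mul_IccExtend hL hw h).coeFn_toLp, hw.coeFn_toLp] with x hprod hwx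
      rw [LinearMap.coe_mk, AddHom.coe_mk, hprod, hwx, norm_mul, mul_comm]
      gcongr
      exact h.norm_coe_le_norm _

theorem coeFn_mulL2 (w : ℝ → ℂ) (hw : MemLp w 2 (volume.restrict (Ioc 0 L))) (h : IntervalC L) :
    mulL2 hL w hw h =ᵐ[volume.restrict (Ioc 0 L)] fun x => w x * IccExtend hL h x :=
  (memLp_mul_IccExtend hL hw h).coeFn_toLp

theorem norm_mulL2_apply_le (w : ℝ → ℂ) (hw : MemLp w 2 (volume.restrict (Ioc 0 L)))
    (h : IntervalC L) : ‖mulL2 hL w hw h‖ ≤ ‖hw.toLp‖ * ‖h‖ :=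
  ContinuousLinearMap.le_of_opNorm_le _ (LinearMap.mkContinuous_norm_le _ (norm_nonneg _) _) h

/-- The inclusion of `C[0, L]` into `L²(0, L)`. -/
noncomputable def inclL2 : IntervalC L →L[ℂ] IntervalL2 L := mulL2 hL (fun _ => 1) (memLp_const 1)

theorem coeFn_inclL2 (h : IntervalC L) :
    inclL2 hL h =ᵐ[volume.restrict (Ioc 0 L)] IccExtend hL h := by
  filter_upwards [coeFn_mulL2 hL (fun _ => 1) (memLp_const 1) h] with x hx
  rw [inclL2, hx, one_mul]

theorem inclL2_injective (hpos : 0 < L) : Function.Injective (inclL2 hpos.le) := by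
  refine (injective_iff_map_eq_zero _).2 fun h hh => ?_
  have hae : IccExtend hpos.le h =ᵐ[volume.restrict (Icc 0 L)] fun _ => (0 : ℂ) := by
    rw [← restrict_Ioc_eq_restrict_Icc]
    refine (coeFn_inclL2 hpos.le h).symm.trans ?_
    rw [hh]
    exact Lp.coeFn_zero _ _ _
  have hzero := Measure.eqOn_Icc_of_ae_eq volume hpos.ne hae
    (continuous_IccExtend hpos.le h).continuousOn continuousOn_const
  ext x
  simpa using hzero x.2

theorem not_finiteDimensional_intervalL2 (hpos : 0 < L) : ¬ FiniteDimensional ℂ (IntervalL2 L) := by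
  intro _
  have : FiniteDimensional ℂ (IntervalC L) :=
    Module.Finite.of_injective (inclL2 hpos.le).toLinearMap (inclL2_injective hpos)
  let coord : IntervalC L :=
    BoundedContinuousFunction.mkOfCompact ⟨fun x => ((x : ℝ) : ℂ), by fun_prop⟩
  obtain ⟨q, hq, hroot⟩ := Algebra.IsIntegral.isIntegral (R := ℂ) coord
  have heval (x : Icc (0 : ℝ) L) : q.eval ((x : ℝ) : ℂ) = 0 := by
    let ev : IntervalC L →ₐ[ℂ] ℂ := (ContinuousMap.evalAlgHom ℂ ℂ x).comp
      (BoundedContinuousFunction.toContinuousMapₐ ℂ)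
    have := Polynomial.hom_eval₂ q (algebraMap ℂ (IntervalC L)) ev.toRingHom coord
    rw [hroot, map_zero] at this
    exact this.symm
  refine hq.ne_zero (Polynomial.eq_zero_of_infinite_isRoot q ?_)
  refine ((Icc_infinite hpos).image Complex.ofReal_injective.injOn).mono ?_
  rintro _ ⟨x, hx, rfl⟩
  exact heval ⟨x, hx⟩

theorem IccExtend_affinePrimitive (a : ℂ) (p : IntervalL2 L) {x : ℝ} (hx : x ∈ Icc 0 L) :
    IccExtend hL (affinePrimitive a p) x = a + ∫ t in (0 : ℝ)..x, p t := by
  rw [IccExtend_of_mem hL _ hx, affinePrimitive_apply]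

theorem inner_inclL2_left (h : IntervalC L) (q : IntervalL2 L) :
    inner ℂ (inclL2 hL h) q = ∫ x in (0 : ℝ)..L, conj (IccExtend hL h x) * q x := by
  rw [L2.inner_def, intervalIntegral.integral_of_le hL]
  refine integral_congr_ae ?_
  filter_upwards [coeFn_inclL2 hL h] with x hx
  rw [hx, RCLike.inner_apply, mul_comm]

theorem inner_inclL2_right (q : IntervalL2 L) (h : IntervalC L) :
    inner ℂ q (inclL2 hL h) = ∫ x in (0 : ℝ)..L, conj (q x) * IccExtend hL h x := by
  rw [L2.inner_def, intervalIntegral.integral_of_le hL]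
  refine integral_congr_ae ?_
  filter_upwards [coeFn_inclL2 hL h] with x hx
  rw [hx, RCLike.inner_apply, mul_comm]

theorem inner_inclL2_affinePrimitive (a b : ℂ) (p q : IntervalL2 L) :
    inner ℂ (inclL2 hL (affinePrimitive a p)) q
      = conj (affinePrimitive a p ⟨L, hL, le_rfl⟩) * affinePrimitive b q ⟨L, hL, le_rfl⟩
        - conj (affinePrimitive a p ⟨0, le_rfl, hL⟩) * affinePrimitive b q ⟨0, le_rfl, hL⟩
        - inner ℂ p (inclL2 hL (affinePrimitive b q)) := by
  have zero_mem : (0 : ℝ) ∈ Icc 0 L := ⟨le_rfl, hL⟩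
  have L_mem : L ∈ Icc 0 L := ⟨hL, le_rfl⟩
  have hq := intervalIntegrable_of_mem_Icc q zero_mem L_mem
  have hp : IntervalIntegrable (fun x => conj (p x)) volume 0 L :=
    intervalIntegrable_iff.2 (Complex.conjCLE.toContinuousLinearMap.integrable_comp
      (intervalIntegrable_iff.1 (intervalIntegrable_of_mem_Icc p zero_mem L_mem)))
  have hP : Continuous fun x => conj (IccExtend hL (affinePrimitive a p) x) :=
    Complex.continuous_conj.comp (continuous_IccExtend hL _)
  have hQ := continuous_IccExtend hL (affinePrimitive b q)
  have by_parts := integral_mul_add_mul_eq_sub hL hp hq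
    (p := fun x => conj (IccExtend hL (affinePrimitive a p) x))
    (q := IccExtend hL (affinePrimitive b q))
    (fun x hx => by
      simp only [IccExtend_affinePrimitive hL a p hx, IccExtend_affinePrimitive hL a p zero_mem,
        intervalIntegral.integral_same, add_zero, map_add, intervalIntegral.integral_of_le hx.1,
        integral_conj])
    (fun x hx => by
      simp only [IccExtend_affinePrimitive hL b q hx, IccExtend_affinePrimitive hL b q zero_mem,
        intervalIntegral.integral_same, add_zero])
  rw [intervalIntegral.integral_add (hp.mul_continuousOn hQ.continuousOn)
    (hq.continuousOn_mul hP.continuousOn), ← inner_inclL2_left, ← inner_inclL2_right,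
    IccExtend_of_mem hL _ zero_mem, IccExtend_of_mem hL _ L_mem, IccExtend_of_mem hL _ zero_mem,
    IccExtend_of_mem hL _ L_mem] at by_parts
  rw [← by_parts, add_sub_cancel_left]

theorem norm_inclL2_sq (h : IntervalC L) :
    ‖inclL2 hL h‖ ^ 2 = ∫ x in (0 : ℝ)..L, ‖IccExtend hL h x‖ ^ 2 := by
  have hinner : inner ℂ (inclL2 hL h) (inclL2 hL h)
      = ∫ x in (0 : ℝ)..L, ((‖IccExtend hL h x‖ ^ 2 : ℝ) : ℂ) := by
    rw [inner_inclL2_left, intervalIntegral.integral_of_le hL, intervalIntegral.integral_of_le hL]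
    refine integral_congr_ae ?_
    filter_upwards [coeFn_inclL2 hL h] with x hx
    rw [hx, RCLike.conj_mul, Complex.ofReal_pow]
    rfl
  rw [intervalIntegral.integral_ofReal, inner_self_eq_norm_sq_to_K] at hinner
  exact Complex.ofReal_injective ((Complex.ofReal_pow _ _).trans hinner)

theorem norm_affinePrimitive_sub_le (a : ℂ) (p : IntervalL2 L) (x y : Icc (0 : ℝ) L) :
    ‖affinePrimitive a p y - affinePrimitive a p x‖ ≤ √|(y : ℝ) - x| * ‖p‖ := by
  rw [affinePrimitive_apply, affinePrimitive_apply, add_sub_add_left_eq_sub]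
  exact norm_integral_sub_le p x.2 y.2

theorem norm_affinePrimitive_apply_sq_le (a : ℂ) (p : IntervalL2 L) (x y : Icc (0 : ℝ) L) :
    ‖affinePrimitive a p y‖ ^ 2
      ≤ 2 * ‖affinePrimitive a p x‖ ^ 2 + 2 * |(y : ℝ) - x| * ‖p‖ ^ 2 := by
  have htri : ‖affinePrimitive a p y‖ ≤ ‖affinePrimitive a p x‖ + √|(y : ℝ) - x| * ‖p‖ :=
    (norm_le_norm_add_norm_sub' _ _).trans
      (add_le_add_right (norm_affinePrimitive_sub_le a p x y) _)
  calc ‖affinePrimitive a p y‖ ^ 2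
      ≤ (‖affinePrimitive a p x‖ + √|(y : ℝ) - x| * ‖p‖) ^ 2 := by gcongr
    _ ≤ 2 * (‖affinePrimitive a p x‖ ^ 2 + (√|(y : ℝ) - x| * ‖p‖) ^ 2) := add_sq_le
    _ = _ := by
      rw [mul_pow, Real.sq_sqrt (abs_nonneg _)]
      ring

theorem exists_mem_Icc_add_subset {δ x : ℝ} (hδ : 0 ≤ δ) (hδL : δ ≤ L) (hx : x ∈ Icc 0 L) :
    ∃ s, x ∈ Icc s (s + δ) ∧ Icc s (s + δ) ⊆ Icc 0 L := by
  refine ⟨min x (L - δ), ⟨min_le_left _ _, ?_⟩,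
    Icc_subset_Icc (le_min hx.1 (sub_nonneg.2 hδL)) ?_⟩
  · rcases min_choice x (L - δ) with h | h <;> rw [h] <;> linarith [hx.2]
  · linarith [min_le_right x (L - δ)]

theorem norm_affinePrimitive_sq_le (a : ℂ) (p : IntervalL2 L) {δ : ℝ} (hδ : 0 < δ)
    (hδL : δ ≤ L) :
    ‖affinePrimitive a p‖ ^ 2
      ≤ 2 / δ * ‖inclL2 hL (affinePrimitive a p)‖ ^ 2 + 2 * δ * ‖p‖ ^ 2 := by
  set F := affinePrimitive a p
  have hcont : Continuous fun t => ‖IccExtend hL F t‖ ^ 2 := (continuous_IccExtend hL F).norm.pow 2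
  have pointwise (x : Icc (0 : ℝ) L) :
      ‖F x‖ ^ 2 ≤ 2 / δ * ‖inclL2 hL F‖ ^ 2 + 2 * δ * ‖p‖ ^ 2 := by
    obtain ⟨s, hxs, hsub⟩ := exists_mem_Icc_add_subset hδ.le hδL x.2
    have hsδ : s ≤ s + δ := by linarith
    have hnear : ∀ t ∈ Icc s (s + δ),
        ‖F x‖ ^ 2 ≤ 2 * ‖IccExtend hL F t‖ ^ 2 + 2 * δ * ‖p‖ ^ 2 := fun t ht => by
      rw [IccExtend_of_mem hL _ (hsub ht)]
      refine (norm_affinePrimitive_apply_sq_le a p ⟨t, hsub ht⟩ x).trans ?_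
      gcongr
      exact abs_sub_le_iff.2 ⟨by linarith [hxs.2, ht.1], by linarith [hxs.1, ht.2]⟩
    have hmean : δ * ‖F x‖ ^ 2
        ≤ 2 * (∫ t in s..(s + δ), ‖IccExtend hL F t‖ ^ 2) + 2 * δ * (δ * ‖p‖ ^ 2) := by
      have hright : Continuous fun t => 2 * ‖IccExtend hL F t‖ ^ 2 + 2 * δ * ‖p‖ ^ 2 :=
        (hcont.const_mul 2).add continuous_const
      have hint := intervalIntegral.integral_mono_on (μ := volume) hsδ intervalIntegrable_const
        (hright.intervalIntegrable _ _) hnear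
      rw [intervalIntegral.integral_add ((hcont.const_mul 2).intervalIntegrable _ _)
        intervalIntegrable_const] at hint
      simpa using hint
    have hmono : ∫ t in s..(s + δ), ‖IccExtend hL F t‖ ^ 2 ≤ ‖inclL2 hL F‖ ^ 2 := by
      rw [norm_inclL2_sq]
      exact intervalIntegral.integral_mono_interval (hsub (left_mem_Icc.2 hsδ)).1 hsδ
        (hsub (right_mem_Icc.2 hsδ)).2 (Filter.Eventually.of_forall fun t => by positivity)
        (hcont.intervalIntegrable _ _)
    refine le_of_mul_le_mul_left ?_ hδ
    calc δ * ‖F x‖ ^ 2 ≤ 2 * ‖inclL2 hL F‖ ^ 2 + 2 * δ * (δ * ‖p‖ ^ 2) := by linarith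
      _ = _ := by field_simp
  rw [← Real.le_sqrt (norm_nonneg _)
    (add_nonneg (mul_nonneg (by positivity) (sq_nonneg _)) (by positivity))]
  exact (F.norm_le (Real.sqrt_nonneg _)).2 fun x => Real.le_sqrt_of_sq_le (pointwise x)

theorem neg_le_re_inner_mulL2 (w : ℝ → ℂ) (hw : MemLp w 2 (volume.restrict (Ioc 0 L)))
    (F : IntervalC L) :
    -(‖hw.toLp‖ ^ 2 / 2 * ‖inclL2 hL F‖ ^ 2 + ‖F‖ ^ 2 / 2)
      ≤ (inner ℂ (inclL2 hL F) (mulL2 hL w hw F)).re := by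
  have hcs : |(inner ℂ (inclL2 hL F) (mulL2 hL w hw F)).re|
      ≤ ‖inclL2 hL F‖ * (‖hw.toLp‖ * ‖F‖) :=
    (Complex.abs_re_le_norm _).trans ((norm_inner_le_norm _ _).trans
      (mul_le_mul_of_nonneg_left (norm_mulL2_apply_le hL w hw F) (norm_nonneg _)))
  nlinarith [(abs_le.1 hcs).1, sq_nonneg (‖inclL2 hL F‖ * ‖hw.toLp‖ - ‖F‖)]

theorem eventually_sup_norm_le_form (hpos : 0 < L) (w : ℝ → ℂ)
    (hw : MemLp w 2 (volume.restrict (Ioc 0 L))) (C : ℝ) :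
    ∀ᶠ κ : ℝ in Filter.atTop, ∀ (a : ℂ) (p : IntervalL2 L),
      C * ‖affinePrimitive a p‖ ^ 2 + ‖inclL2 hL (affinePrimitive a p)‖ ^ 2
      ≤ ‖p‖ ^ 2 + (inner ℂ (inclL2 hL (affinePrimitive a p))
          (mulL2 hL w hw (affinePrimitive a p))).re
        + κ * ‖inclL2 hL (affinePrimitive a p)‖ ^ 2 := by
  set K := |C| + 1 with hK
  set δ := min L (1 / (2 * K))
  have hδ : 0 < δ := lt_min hpos (by positivity)
  have hKδ : K * (2 * δ) ≤ 1 := by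
    have : δ * (2 * K) ≤ 1 := (le_div_iff₀ (by positivity)).1 (min_le_right _ _)
    linarith
  filter_upwards [Filter.eventually_ge_atTop (1 + ‖hw.toLp‖ ^ 2 / 2 + K * (2 / δ))]
    with κ hκ a p
  set F := affinePrimitive a p
  set N := ‖inclL2 hL F‖
  have sobolev : K * ‖F‖ ^ 2 ≤ K * (2 / δ) * N ^ 2 + ‖p‖ ^ 2 :=
    calc K * ‖F‖ ^ 2 ≤ K * (2 / δ * N ^ 2 + 2 * δ * ‖p‖ ^ 2) := by
          gcongr
          exact norm_affinePrimitive_sq_le hL a p hδ (min_le_left _ _)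
      _ = K * (2 / δ) * N ^ 2 + K * (2 * δ) * ‖p‖ ^ 2 := by ring
      _ ≤ K * (2 / δ) * N ^ 2 + ‖p‖ ^ 2 := by
          gcongr
          exact mul_le_of_le_one_left (sq_nonneg _) hKδ
  have hC : C * ‖F‖ ^ 2 ≤ |C| * ‖F‖ ^ 2 := by
    gcongr
    exact le_abs_self C
  have hκN := mul_le_mul_of_nonneg_right hκ (sq_nonneg N)
  have potential := neg_le_re_inner_mulL2 hL w hw F
  rw [hK, add_mul, one_mul] at sobolev
  linarith [sq_nonneg ‖F‖]

theorem hasDerivWithinAt_affinePrimitive_inclL2 (c : ℂ) (D : IntervalC L) {x : ℝ}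
    (hx : x ∈ Icc 0 L) :
    HasDerivWithinAt (IccExtend hL (affinePrimitive c (inclL2 hL D))) (IccExtend hL D x)
      (Icc 0 L) x := by
  have hprim : ∀ y ∈ Icc 0 L, IccExtend hL (affinePrimitive c (inclL2 hL D)) y
      = c + ∫ t in (0 : ℝ)..y, IccExtend hL D t := fun y hy => by
    rw [IccExtend_affinePrimitive hL _ _ hy, integral_congr_ae_of_mem (coeFn_inclL2 hL D) hy]
  exact (((continuous_IccExtend hL D).integral_hasStrictDerivAt 0 x).hasDerivAt.const_add
    c).hasDerivWithinAt.congr hprim (hprim x hx)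

theorem eq_affinePrimitive_of_hasL2Deriv {f g : ℝ → ℂ} (hf : DifferentiableOn ℝ f (Icc 0 L))
    (hg : MetricGraph.HasL2Deriv L (derivWithin f (Icc 0 L)) g) (x : Icc (0 : ℝ) L) :
    f x = affinePrimitive (f 0)
      (inclL2 hL (affinePrimitive (derivWithin f (Icc 0 L) 0) hg.1.toLp)) x := by
  set D := affinePrimitive (derivWithin f (Icc 0 L) 0) hg.1.toLp
  have hD : ∀ y ∈ Icc 0 L, derivWithin f (Icc 0 L) y = IccExtend hL D y := fun y hy => by
    rw [hg.2 y hy, IccExtend_affinePrimitive hL _ _ hy,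
      integral_congr_ae_of_mem hg.1.coeFn_toLp hy]
  have hderiv : ∀ y ∈ Ioo 0 (x : ℝ), HasDerivAt f (IccExtend hL D y) y := fun y hy => by
    have hyL : y ∈ Ioo 0 L := ⟨hy.1, hy.2.trans_le x.2.2⟩
    rw [← hD y (Ioo_subset_Icc_self hyL)]
    exact (hf y (Ioo_subset_Icc_self hyL)).hasDerivWithinAt.hasDerivAt
      (Icc_mem_nhds hyL.1 hyL.2)
  have ftc : ∫ t in (0 : ℝ)..x, IccExtend hL D t = f x - f 0 :=
    intervalIntegral.integral_eq_sub_of_hasDerivAt_of_le x.2.1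
      (hf.continuousOn.mono (Icc_subset_Icc_right x.2.2)) hderiv
      ((continuous_IccExtend hL D).intervalIntegrable _ _)
  rw [affinePrimitive_apply, integral_congr_ae_of_mem (coeFn_inclL2 hL D) x.2, ftc,
    add_sub_cancel]

end IntervalSpaces

theorem exists_linearMap_graph_mem {K V W : Type*} [DivisionRing K] [AddCommGroup V] [Module K V]
    [AddCommGroup W] [Module K W] (D : Submodule K (V × W)) :
    ∃ r : V →ₗ[K] W, ∀ p ∈ D, (p.1, r p.1) ∈ D := by
  let fst : D →ₗ[K] V := (LinearMap.fst K V W).comp D.subtype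
  obtain ⟨s, hs⟩ := fst.rangeRestrict.exists_rightInverse_of_surjective fst.range_rangeRestrict
  obtain ⟨r, hr⟩ := ((LinearMap.snd K V W).comp (D.subtype.comp s)).exists_extend
  refine ⟨r, fun p hp => ?_⟩
  let x : LinearMap.range fst := ⟨p.1, ⟨p, hp⟩, rfl⟩
  have hfst : (s x : V × W).1 = p.1 := congrArg Subtype.val (LinearMap.congr_fun hs x)
  have hsnd : r p.1 = (s x : V × W).2 := LinearMap.congr_fun hr x
  rw [← hfst, hfst, hsnd, ← hfst]
  exact (s x).2

namespace SelfAdjointCondition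

open Matrix
open scoped ComplexOrder

variable {ι : Type*} [Fintype ι] (S : SelfAdjointCondition ι)

theorem mul_conjTranspose_comm : S.B * S.Aᴴ = S.A * S.Bᴴ := by
  have := S.hermitian
  rwa [IsHermitian, conjTranspose_mul, conjTranspose_conjTranspose] at this

theorem eq_zero_of_conjTranspose_mulVec_eq_zero {c : ι → ℂ} (hA : S.Aᴴ *ᵥ c = 0)
    (hB : S.Bᴴ *ᵥ c = 0) : c = 0 := by
  have hrank : (fromCols S.A S.B)ᴴ.rank = Fintype.card ι := by
    classical rw [rank_conjTranspose, S.rank_eq]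
  have hdim := (fromCols S.A S.B)ᴴ.mulVecLin.finrank_range_add_finrank_ker
  rw [Module.finrank_fintype_fun_eq_card, ← hrank, Matrix.rank, Nat.add_eq_left,
    Submodule.finrank_eq_zero] at hdim
  refine LinearMap.ker_eq_bot'.1 hdim c ?_
  rw [mulVecLin_apply, conjTranspose_fromCols_eq_fromRows_conjTranspose, fromRows_mulVec, hA, hB]
  exact Sum.elim_zero_zero

/-- The map `c ↦ (-B* c, A* c)`, which parametrizes the vertex condition. -/
noncomputable def param : (ι → ℂ) →ₗ[ℂ] (ι → ℂ) × (ι → ℂ) :=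
  (-S.Bᴴ.mulVecLin).prod S.Aᴴ.mulVecLin

theorem range_param : LinearMap.range S.param
    = LinearMap.ker (S.A.mulVecLin.coprod S.B.mulVecLin) := by
  refine Submodule.eq_of_le_of_finrank_eq ?_ ?_
  · rintro _ ⟨c, rfl⟩
    simp [param, mulVec_neg, mul_conjTranspose_comm]
  have hinj : Function.Injective S.param := (injective_iff_map_eq_zero _).2 fun c hc =>
    S.eq_zero_of_conjTranspose_mulVec_eq_zero (congrArg Prod.snd hc)
      (neg_eq_zero.1 (congrArg Prod.fst hc))
  have hrange : Module.finrank ℂ (LinearMap.range (S.A.mulVecLin.coprod S.B.mulVecLin))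
      = Fintype.card ι := by
    have hcol : (fromCols S.A S.B).col = Sum.elim S.A.col S.B.col := by
      ext (i | i) <;> rfl
    rw [← S.rank_eq, Matrix.rank, LinearMap.range_coprod, range_mulVecLin, range_mulVecLin,
      range_mulVecLin, ← Submodule.span_union, hcol, Sum.elim_range]
  have hdim := (S.A.mulVecLin.coprod S.B.mulVecLin).finrank_range_add_finrank_ker
  rw [hrange, Module.finrank_prod, Module.finrank_fintype_fun_eq_card] at hdim
  rw [LinearMap.finrank_range_of_inj hinj, Module.finrank_fintype_fun_eq_card]
  exact (Nat.add_left_cancel hdim).symm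

theorem exists_eq_of_condition {F F' : ι → ℂ} (h : S.A *ᵥ F + S.B *ᵥ F' = 0) :
    ∃ c, F = -(S.Bᴴ *ᵥ c) ∧ F' = S.Aᴴ *ᵥ c := by
  obtain ⟨c, hc⟩ : (F, F') ∈ LinearMap.range S.param := S.range_param ▸ h
  exact ⟨c, (congrArg Prod.fst hc).symm, (congrArg Prod.snd hc).symm⟩

theorem dotProduct_star_comm {F F' G G' : ι → ℂ} (h : S.A *ᵥ F + S.B *ᵥ F' = 0)
    (h' : S.A *ᵥ G + S.B *ᵥ G' = 0) : F' ⬝ᵥ star G = F ⬝ᵥ star G' := by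
  obtain ⟨c, rfl, rfl⟩ := S.exists_eq_of_condition h
  obtain ⟨d, rfl, rfl⟩ := S.exists_eq_of_condition h'
  have adjoint (X Y : Matrix ι ι ℂ) :
      Xᴴ *ᵥ c ⬝ᵥ star (Yᴴ *ᵥ d) = star d ⬝ᵥ (Y * Xᴴ) *ᵥ c := by
    rw [star_mulVec, conjTranspose_conjTranspose, dotProduct_comm, ← dotProduct_mulVec,
      mulVec_mulVec]
  rw [star_neg, dotProduct_neg, neg_dotProduct, adjoint, adjoint, mul_conjTranspose_comm]

theorem exists_norm_dotProduct_star_le : ∃ C : ℝ, ∀ F F' : ι → ℂ,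
    S.A *ᵥ F + S.B *ᵥ F' = 0 → ‖F' ⬝ᵥ star F‖ ≤ C * ‖F‖ ^ 2 := by
  obtain ⟨r, hr⟩ := exists_linearMap_graph_mem
    (LinearMap.ker (S.A.mulVecLin.coprod S.B.mulVecLin))
  let rc : (ι → ℂ) →L[ℂ] (ι → ℂ) := LinearMap.toContinuousLinearMap r
  refine ⟨Fintype.card ι * ‖rc‖, fun F F' h => ?_⟩
  have hrF : S.A *ᵥ F + S.B *ᵥ r F = 0 := hr (F, F') h
  have hterm (b : ι) : ‖rc F b * star F b‖ ≤ ‖rc‖ * ‖F‖ ^ 2 := by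
    rw [norm_mul, Pi.star_apply, norm_star, sq, ← mul_assoc]
    gcongr
    · exact (norm_le_pi_norm _ b).trans (rc.le_opNorm F)
    · exact norm_le_pi_norm F b
  calc ‖F' ⬝ᵥ star F‖ = ‖rc F ⬝ᵥ star F‖ := by
        rw [S.dotProduct_star_comm h hrF, ← S.dotProduct_star_comm hrF hrF]
        rfl
    _ ≤ ∑ _b : ι, ‖rc‖ * ‖F‖ ^ 2 := norm_sum_le_of_le _ fun b _ => hterm b
    _ = Fintype.card ι * ‖rc‖ * ‖F‖ ^ 2 := by
        rw [Finset.sum_const, nsmul_eq_mul, Finset.card_univ, mul_assoc]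

end SelfAdjointCondition

theorem isCompactOperator_pi {X ι : Type*} [Finite ι] [Zero X] [TopologicalSpace X] {Y : ι → Type*}
    [∀ i, TopologicalSpace (Y i)] {f : X → ∀ i, Y i}
    (hf : ∀ i, IsCompactOperator fun x => f x i) : IsCompactOperator f := by
  choose K hK hmem using hf
  refine ⟨univ.pi K, isCompact_univ_pi hK, ?_⟩
  filter_upwards [Filter.iInter_mem.2 hmem] with x hx i _ using mem_iInter.1 hx i

/-- Constant functions, as a continuous linear map into `C[0, L]`. -/
noncomputable def constL (L : ℝ) : ℂ →L[ℂ] IntervalC L :=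
  LinearMap.toContinuousLinearMap
    { toFun := BoundedContinuousFunction.const (Icc 0 L)
      map_add' := fun _ _ => rfl
      map_smul' := fun _ _ => rfl }

namespace MetricGraph

open scoped ComplexConjugate BoundedContinuousFunction Matrix

section SobolevData

variable {V E : Type*} (Γ : MetricGraph V E)

/-- The Hilbert space `L²(Γ)`. -/
abbrev L2 : Type _ := PiLp 2 fun e => IntervalL2 (Γ.len e)

/-- The space `H²` of the disjoint union of the edges, parametrized by initial data and second
derivatives: `(c, g)` stands for the function with `f(0) = c (e, false)`, `f'(0) = c (e, true)` and
`f'' = g e` on the edge `e`. -/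
abbrev H2Data : Type _ := (E × Bool → ℂ) × Γ.L2

variable {Γ}

/-- The derivative on the edge `e` of the function with the given data. -/
noncomputable def edgeDerivL (e : E) : Γ.H2Data →L[ℂ] IntervalC (Γ.len e) :=
  (constL (Γ.len e)).comp
      ((ContinuousLinearMap.proj (e, true)).comp (ContinuousLinearMap.fst ℂ _ _))
    + (primitive (Γ.len e)).comp ((PiLp.proj 2 (fun e => IntervalL2 (Γ.len e)) e).comp
      (ContinuousLinearMap.snd ℂ _ _))

/-- The restriction to the edge `e` of the function with the given data. -/
noncomputable def edgeValL (e : E) : Γ.H2Data →L[ℂ] IntervalC (Γ.len e) :=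
  (constL (Γ.len e)).comp
      ((ContinuousLinearMap.proj (e, false)).comp (ContinuousLinearMap.fst ℂ _ _))
    + (primitive (Γ.len e)).comp ((inclL2 (Γ.len_pos e).le).comp (edgeDerivL e))

theorem isCompactOperator_edgeValL (e : E) : IsCompactOperator (edgeValL (Γ := Γ) e) :=
  ((isCompactOperator_of_locallyCompactSpace_rng (constL (Γ.len e))).comp_clm _).add
    ((isCompactOperator_primitive (Γ.len e)).comp_clm _)

theorem edgeDerivL_apply (e : E) (y : Γ.H2Data) :
    edgeDerivL e y = affinePrimitive (y.1 (e, true)) (y.2 e) := rfl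

theorem edgeValL_apply (e : E) (y : Γ.H2Data) :
    edgeValL e y = affinePrimitive (y.1 (e, false)) (inclL2 (Γ.len_pos e).le (edgeDerivL e y)) :=
  rfl

/-- The function on the graph with the given data. -/
noncomputable def ofData : Γ.H2Data →ₗ[ℂ] Γ.Fun where
  toFun y e x := edgeValL e y x
  map_add' y z := by
    funext e x
    rw [map_add]
    rfl
  map_smul' c y := by
    funext e x
    rw [map_smul]
    rfl

theorem onEdge_ofData (y : Γ.H2Data) (e : E) :
    onEdge (ofData y) e = IccExtend (Γ.len_pos e).le (edgeValL e y) := rfl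

theorem hasDerivWithinAt_onEdge_ofData (y : Γ.H2Data) (e : E) {x : ℝ} (hx : x ∈ Icc 0 (Γ.len e)) :
    HasDerivWithinAt (onEdge (ofData y) e) (IccExtend (Γ.len_pos e).le (edgeDerivL e y) x)
      (Icc 0 (Γ.len e)) x :=
  hasDerivWithinAt_affinePrimitive_inclL2 (Γ.len_pos e).le _ _ hx

theorem edgeDeriv_ofData (y : Γ.H2Data) (e : E) {x : ℝ} (hx : x ∈ Icc 0 (Γ.len e)) :
    edgeDeriv (ofData y) e x = IccExtend (Γ.len_pos e).le (edgeDerivL e y) x :=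
  (hasDerivWithinAt_onEdge_ofData y e hx).derivWithin (uniqueDiffOn_Icc (Γ.len_pos e) x hx)

theorem hasSecondDeriv_ofData (y : Γ.H2Data) (e : E) : HasSecondDeriv (ofData y) e (y.2 e) := by
  refine ⟨fun x hx => (hasDerivWithinAt_onEdge_ofData y e hx).differentiableWithinAt,
    Lp.memLp _, fun x hx => ?_⟩
  rw [edgeDeriv_ofData y e hx, edgeDeriv_ofData y e (endpts_mem e).1, edgeDerivL_apply,
    IccExtend_affinePrimitive _ _ _ hx, IccExtend_affinePrimitive _ _ _ (endpts_mem e).1,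
    intervalIntegral.integral_same, add_zero]

theorem exists_ofData_eq {f : Γ.Fun} {g : E → ℝ → ℂ} (h : ∀ e, HasSecondDeriv f e (g e)) :
    ∃ y : Γ.H2Data, ofData y = f ∧ ∀ e, y.2 e =ᵐ[volume.restrict (Ioc 0 (Γ.len e))] g e := by
  refine ⟨(fun b => if b.2 then edgeDeriv f b.1 0 else onEdge f b.1 0,
    WithLp.toLp 2 fun e => (h e).2.1.toLp), ?_, fun e => (h e).2.1.coeFn_toLp⟩
  funext e x
  rw [← IccExtend_val (Γ.len_pos e).le (f e) x]
  exact (eq_affinePrimitive_of_hasL2Deriv (Γ.len_pos e).le (h e).1 (h e).2 x).symm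

/-- The position of an edge end on its edge. -/
noncomputable def endPoint (Γ : MetricGraph V E) (b : E × Bool) : Icc (0 : ℝ) (Γ.len b.1) :=
  if b.2 then ⟨Γ.len b.1, (endpts_mem b.1).2⟩ else ⟨0, (endpts_mem b.1).1⟩

/-- The values at the edge ends of the function with the given data. -/
noncomputable def endValL : Γ.H2Data →L[ℂ] (E × Bool → ℂ) :=
  ContinuousLinearMap.pi fun b =>
    (BoundedContinuousFunction.evalCLM ℂ (endPoint Γ b)).comp (edgeValL b.1)

/-- The derivatives, into the edges, at the edge ends of the function with the given data. -/
noncomputable def endDerivL : Γ.H2Data →L[ℂ] (E × Bool → ℂ) :=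
  ContinuousLinearMap.pi fun b => (if b.2 then -1 else 1 : ℂ) •
    (BoundedContinuousFunction.evalCLM ℂ (endPoint Γ b)).comp (edgeDerivL b.1)

theorem endValL_apply (y : Γ.H2Data) (b : E × Bool) :
    endValL y b = edgeValL b.1 y (endPoint Γ b) := rfl

theorem endDerivL_apply (y : Γ.H2Data) (b : E × Bool) :
    endDerivL y b = (if b.2 then -1 else 1 : ℂ) * edgeDerivL b.1 y (endPoint Γ b) := rfl

theorem endVal_ofData (y : Γ.H2Data) (b : E × Bool) : endVal (ofData y) b = endValL y b := by
  obtain ⟨e, _ | _⟩ := b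
  · exact IccExtend_of_mem (Γ.len_pos e).le _ (endpts_mem e).1
  · exact IccExtend_of_mem (Γ.len_pos e).le _ (endpts_mem e).2

theorem endDeriv_ofData (y : Γ.H2Data) (b : E × Bool) : endDeriv (ofData y) b = endDerivL y b := by
  obtain ⟨e, _ | _⟩ := b
  · simp only [endDeriv, endDerivL_apply, endPoint, Bool.false_eq_true, if_false, one_mul]
    rw [edgeDeriv_ofData y e (endpts_mem e).1, IccExtend_of_mem]
  · simp only [endDeriv, endDerivL_apply, endPoint, if_true, neg_mul, one_mul]
    rw [edgeDeriv_ofData y e (endpts_mem e).2, IccExtend_of_mem]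

/-- An operator from functions on the graph to `L²(Γ)` that acts edge by edge. -/
noncomputable def edgewise (T : ∀ e, IntervalC (Γ.len e) →L[ℂ] IntervalL2 (Γ.len e)) :
    Γ.H2Data →L[ℂ] Γ.L2 :=
  ((PiLp.continuousLinearEquiv 2 ℂ fun e => IntervalL2 (Γ.len e)).symm :
      ((e : E) → IntervalL2 (Γ.len e)) →L[ℂ] Γ.L2).comp
    (ContinuousLinearMap.pi fun e => (T e).comp (edgeValL e))

theorem isCompactOperator_edgewise [Finite E]
    (T : ∀ e, IntervalC (Γ.len e) →L[ℂ] IntervalL2 (Γ.len e)) : IsCompactOperator (edgewise T) :=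
  (isCompactOperator_pi fun e =>
    (isCompactOperator_edgeValL e).clm_comp (T e)).clm_comp
    ((PiLp.continuousLinearEquiv 2 ℂ fun e => IntervalL2 (Γ.len e)).symm :
      ((e : E) → IntervalL2 (Γ.len e)) →L[ℂ] Γ.L2)

/-- The inclusion of `H²` functions into `L²(Γ)`. -/
noncomputable def toL2 : Γ.H2Data →L[ℂ] Γ.L2 := edgewise fun e => inclL2 (Γ.len_pos e).le

theorem toL2_apply (y : Γ.H2Data) (e : E) :
    toL2 y e = inclL2 (Γ.len_pos e).le (edgeValL e y) := rfl

theorem eq_zero_of_ofData_eq_zero {y : Γ.H2Data} (hy : ofData y = 0) : y = 0 := by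
  have val_eq_zero (e : E) : edgeValL e y = 0 :=
    BoundedContinuousFunction.ext fun x => congrFun (congrFun hy e) x
  have deriv_eq_zero (e : E) : edgeDerivL e y = 0 := by
    ext x
    have hderiv := edgeDeriv_ofData y e x.2
    rw [IccExtend_of_mem _ _ x.2, edgeDeriv, onEdge_ofData, val_eq_zero e] at hderiv
    exact hderiv.symm.trans (congrFun (derivWithin_const _ _) _)
  have initial_eq_zero : y.1 = 0 := by
    funext ⟨e, i⟩
    cases i with
    | false => simpa [edgeValL_apply, affinePrimitive_apply] using
        DFunLike.congr_fun (val_eq_zero e) ⟨0, (endpts_mem e).1⟩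
    | true => simpa [edgeDerivL_apply, affinePrimitive_apply] using
        DFunLike.congr_fun (deriv_eq_zero e) ⟨0, (endpts_mem e).1⟩
  refine Prod.ext initial_eq_zero (PiLp.ext fun e => primitive_injective (Γ.len_pos e).le ?_)
  have hprimitive := deriv_eq_zero e
  rw [edgeDerivL_apply, affinePrimitive, initial_eq_zero] at hprimitive
  exact (zero_add _).symm.trans (hprimitive.trans (map_zero _).symm)

theorem ofData_injective : Function.Injective (ofData (Γ := Γ)) :=
  (injective_iff_map_eq_zero _).2 fun _ => eq_zero_of_ofData_eq_zero

theorem toL2_injective : Function.Injective (toL2 (Γ := Γ)) := by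
  refine (injective_iff_map_eq_zero _).2 fun y hy => eq_zero_of_ofData_eq_zero ?_
  have val_eq_zero (e : E) : edgeValL e y = 0 :=
    inclL2_injective (Γ.len_pos e) (by rw [← toL2_apply, hy, map_zero]; rfl)
  funext e x
  exact DFunLike.congr_fun (val_eq_zero e) x

end SobolevData

section Form

variable {V E : Type*} {Γ : MetricGraph V E} {W : E → ℝ → ℝ}
  (hW : ∀ e, MemLp (W e) 2 (volume.restrict (Ioc 0 (Γ.len e)))) (κ : ℝ)

/-- Multiplication by the shifted potential `W + κ` on the edge `e`. -/
noncomputable def edgePotential (e : E) : IntervalC (Γ.len e) →L[ℂ] IntervalL2 (Γ.len e) :=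
  mulL2 (Γ.len_pos e).le (fun x => (W e x : ℂ)) (hW e).ofReal + (κ : ℂ) • inclL2 (Γ.len_pos e).le

theorem coeFn_edgePotential (e : E) (h : IntervalC (Γ.len e)) :
    edgePotential hW κ e h =ᵐ[volume.restrict (Ioc 0 (Γ.len e))]
      fun x => ((W e x + κ : ℝ) : ℂ) * IccExtend (Γ.len_pos e).le h x := by
  filter_upwards [coeFn_mulL2 (Γ.len_pos e).le (fun x => (W e x : ℂ)) (hW e).ofReal h,
    coeFn_inclL2 (Γ.len_pos e).le h,
    Lp.coeFn_add (mulL2 (Γ.len_pos e).le (fun x => (W e x : ℂ)) (hW e).ofReal h)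
      ((κ : ℂ) • inclL2 (Γ.len_pos e).le h),
    Lp.coeFn_smul (κ : ℂ) (inclL2 (Γ.len_pos e).le h)] with x hmul hincl hadd hsmul
  refine hadd.trans ?_
  rw [Complex.ofReal_add, add_mul, Pi.add_apply, hsmul, Pi.smul_apply, hincl, smul_eq_mul]
  exact congrArg (· + _) hmul

theorem inner_inclL2_edgePotential_comm (e : E) (h k : IntervalC (Γ.len e)) :
    inner ℂ (inclL2 (Γ.len_pos e).le h) (edgePotential hW κ e k)
      = inner ℂ (edgePotential hW κ e h) (inclL2 (Γ.len_pos e).le k) := by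
  rw [inner_inclL2_left, inner_inclL2_right,
    intervalIntegral.integral_of_le (Γ.len_pos e).le,
    intervalIntegral.integral_of_le (Γ.len_pos e).le]
  refine integral_congr_ae ?_
  filter_upwards [coeFn_edgePotential hW κ e h, coeFn_edgePotential hW κ e k] with x hh hk
  rw [hh, hk, map_mul, Complex.conj_ofReal]
  ring

variable [Fintype E]

/-- The differential expression `-f'' + W f + κ f`. -/
noncomputable def hamL2 : Γ.H2Data →L[ℂ] Γ.L2 :=
  edgewise (edgePotential hW κ) - ContinuousLinearMap.snd ℂ (E × Bool → ℂ) Γ.L2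

theorem hamL2_apply (y : Γ.H2Data) (e : E) :
    hamL2 hW κ y e = edgePotential hW κ e (edgeValL e y) - y.2 e := rfl

/-- The sesquilinear form `∫ conj z' y' + (W + κ) conj z y` of `-d²/dx² + W + κ`, without boundary
terms. -/
noncomputable def form (z y : Γ.H2Data) : ℂ :=
  ∑ e, (inner ℂ (inclL2 (Γ.len_pos e).le (edgeDerivL e z))
      (inclL2 (Γ.len_pos e).le (edgeDerivL e y))
    + inner ℂ (inclL2 (Γ.len_pos e).le (edgeValL e z)) (edgePotential hW κ e (edgeValL e y)))

theorem conj_form (z y : Γ.H2Data) : conj (form hW κ z y) = form hW κ y z := by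
  simp only [form, map_sum, map_add, inner_conj_symm, inner_inclL2_edgePotential_comm]

theorem inner_toL2_hamL2 (y z : Γ.H2Data) :
    inner ℂ (toL2 z) (hamL2 hW κ y) = form hW κ z y + endDerivL y ⬝ᵥ star (endValL z) := by
  rw [PiLp.inner_apply, form, dotProduct, Fintype.sum_prod_type, ← Finset.sum_add_distrib]
  refine Finset.sum_congr rfl fun e _ => ?_
  have by_parts := inner_inclL2_affinePrimitive (Γ.len_pos e).le (z.1 (e, false)) (y.1 (e, true))
    (inclL2 (Γ.len_pos e).le (edgeDerivL e z)) (y.2 e)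
  rw [← edgeValL_apply, ← edgeDerivL_apply] at by_parts
  rw [toL2_apply, hamL2_apply, inner_sub_right, by_parts, Fintype.sum_bool]
  simp only [Pi.star_apply, RCLike.star_def, endValL_apply, endDerivL_apply, endPoint, if_true,
    Bool.false_eq_true, if_false]
  ring

theorem inner_toL2_hamL2_sub (y z : Γ.H2Data) :
    inner ℂ (toL2 z) (hamL2 hW κ y) - inner ℂ (hamL2 hW κ z) (toL2 y)
      = endDerivL y ⬝ᵥ star (endValL z) - endValL y ⬝ᵥ star (endDerivL z) := by
  rw [← inner_conj_symm (hamL2 hW κ z), inner_toL2_hamL2, inner_toL2_hamL2, map_add, conj_form,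
    ← RCLike.star_def, ← Matrix.star_dotProduct_star, star_star]
  ring

theorem eventually_sum_norm_edgeValL_le_form (C : ℝ) :
    ∀ᶠ κ in Filter.atTop, ∀ y : Γ.H2Data,
      C * ∑ e, ‖edgeValL e y‖ ^ 2 + ‖toL2 y‖ ^ 2 ≤ (form hW κ y y).re := by
  filter_upwards [Filter.eventually_all.2 fun e => eventually_sup_norm_le_form (Γ.len_pos e).le
    (Γ.len_pos e) _ (hW e).ofReal C] with κ hκ y
  rw [PiLp.norm_sq_eq_of_L2, form, Complex.re_sum, Finset.mul_sum, ← Finset.sum_add_distrib]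
  refine Finset.sum_le_sum fun e _ => ?_
  have hedge := hκ e (y.1 (e, false)) (inclL2 (Γ.len_pos e).le (edgeDerivL e y))
  rw [← edgeValL_apply] at hedge
  have hpot : (inner ℂ (inclL2 (Γ.len_pos e).le (edgeValL e y))
      (edgePotential hW κ e (edgeValL e y))).re = (inner ℂ (inclL2 (Γ.len_pos e).le (edgeValL e y))
        (mulL2 (Γ.len_pos e).le (fun x => (W e x : ℂ)) (hW e).ofReal (edgeValL e y))).re
        + κ * ‖inclL2 (Γ.len_pos e).le (edgeValL e y)‖ ^ 2 := by
    rw [edgePotential, add_apply, inner_add_right, Complex.add_re,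
      smul_apply, inner_smul_right, Complex.re_ofReal_mul]
    exact congrArg _ (congrArg _ (inner_self_eq_norm_sq (𝕜 := ℂ) _))
  have hder := inner_self_eq_norm_sq (𝕜 := ℂ) (inclL2 (Γ.len_pos e).le (edgeDerivL e y))
  rw [toL2_apply, Complex.add_re, hpot, ← add_assoc, ← RCLike.re_eq_complex_re, hder]
  exact hedge

end Form

section VertexData

variable {V E : Type*} {Γ : MetricGraph V E}

/-- The vector `F(u)` of the function with the given data. -/
noncomputable def vertexValL (u : V) : Γ.H2Data →L[ℂ] (Γ.Star u → ℂ) :=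
  ContinuousLinearMap.pi fun b => (ContinuousLinearMap.proj b.1).comp endValL

/-- The vector `F'(u)` of the function with the given data. -/
noncomputable def vertexDerivL (u : V) : Γ.H2Data →L[ℂ] (Γ.Star u → ℂ) :=
  ContinuousLinearMap.pi fun b => (ContinuousLinearMap.proj b.1).comp endDerivL

theorem vertexVal_ofData (y : Γ.H2Data) (u : V) : vertexVal (ofData y) u = vertexValL u y :=
  funext fun b => endVal_ofData y b.1

theorem vertexDeriv_ofData (y : Γ.H2Data) (u : V) : vertexDeriv (ofData y) u = vertexDerivL u y :=
  funext fun b => endDeriv_ofData y b.1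

variable [Fintype E] [DecidableEq V]

theorem sum_eq_sum_star [Fintype V] {M : Type*} [AddCommMonoid M] (φ : E × Bool → M) :
    ∑ b, φ b = ∑ u, ∑ b : Γ.Star u, φ b.1 := by
  rw [← Fintype.sum_sigma' fun u (b : Γ.Star u) => φ b.1]
  exact (Equiv.sum_comp (Equiv.sigmaFiberEquiv fun b : E × Bool => Γ.endpt b.1 b.2) φ).symm

theorem norm_vertexValL_sq_le (u : V) (y : Γ.H2Data) :
    ‖vertexValL u y‖ ^ 2 ≤ ∑ e, ‖edgeValL e y‖ ^ 2 := by
  rw [← Real.le_sqrt (norm_nonneg _) (by positivity)]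
  refine (pi_norm_le_iff_of_nonneg (Real.sqrt_nonneg _)).2 fun b => Real.le_sqrt_of_sq_le ?_
  calc ‖edgeValL b.1.1 y (endPoint Γ b.1)‖ ^ 2 ≤ ‖edgeValL b.1.1 y‖ ^ 2 := by
        gcongr
        exact BoundedContinuousFunction.norm_coe_le_norm _ _
    _ ≤ ∑ e, ‖edgeValL e y‖ ^ 2 :=
        Finset.single_le_sum (f := fun e => ‖edgeValL e y‖ ^ 2) (fun _ _ => sq_nonneg _)
          (Finset.mem_univ b.1.1)

/-- The common value at `v` of a function that is continuous there, encoded as the mean value over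
the edge ends at `v` so that it is linear in the data; it is `0` if there are no such ends. -/
noncomputable def vval (v : V) : Γ.H2Data →L[ℂ] ℂ :=
  (Fintype.card (Γ.Star v) : ℂ)⁻¹ • ∑ b : Γ.Star v, (ContinuousLinearMap.proj b).comp (vertexValL v)

/-- The sum `∑ f'(v)` of the derivatives at `v`. -/
noncomputable def vder (v : V) : Γ.H2Data →L[ℂ] ℂ :=
  ∑ b : Γ.Star v, (ContinuousLinearMap.proj b).comp (vertexDerivL v)

theorem vval_apply (v : V) (y : Γ.H2Data) :
    vval v y = (Fintype.card (Γ.Star v) : ℂ)⁻¹ * ∑ b : Γ.Star v, vertexValL v y b := by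
  simp [vval]

theorem vder_apply (v : V) (y : Γ.H2Data) : vder v y = ∑ b : Γ.Star v, vertexDerivL v y b := by
  simp [vder]

theorem vval_eq_of_forall_eq {v : V} {y : Γ.H2Data}
    (hy : ∀ b b' : Γ.Star v, vertexValL v y b = vertexValL v y b') (b : Γ.Star v) :
    vertexValL v y b = vval v y := by
  have : Nonempty (Γ.Star v) := ⟨b⟩
  rw [vval_apply, Finset.sum_congr rfl fun b' _ => hy b' b, Finset.sum_const, Finset.card_univ,
    nsmul_eq_mul, inv_mul_cancel_left₀ (Nat.cast_ne_zero.2 Fintype.card_ne_zero)]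

/-- The failure of the linear relation `∑ f'(v) = α f(v)` (for `α = ∞`: `f(v) = 0`). -/
noncomputable def deltaDefect (v : V) : WithTop ℝ → Γ.H2Data →L[ℂ] ℂ
  | none => vval v
  | some a => vder v - (a : ℂ) • vval v

theorem deltaDefect_top (v : V) (y : Γ.H2Data) : deltaDefect v ⊤ y = vval v y := rfl

theorem deltaDefect_coe (v : V) (a : ℝ) (y : Γ.H2Data) :
    deltaDefect v a y = vder v y - a * vval v y := rfl

theorem deltaDefect_eq_zero_of_isEmpty (v : V) [IsEmpty (Γ.Star v)] (α : WithTop ℝ)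
    (y : Γ.H2Data) : deltaDefect v α y = 0 := by
  cases α with
  | top => simp [deltaDefect_top, vval_apply]
  | coe a => simp [deltaDefect_coe, vval_apply, vder_apply]

/-- The deviations of the values at `v` from their mean. -/
noncomputable def valueDefect (v : V) : Γ.H2Data →L[ℂ] (Γ.Star v → ℂ) :=
  vertexValL v - ContinuousLinearMap.pi fun _ => vval v

theorem valueDefect_eq_zero_iff {v : V} {y : Γ.H2Data} :
    valueDefect v y = 0 ↔ ∀ b b' : Γ.Star v, vertexValL v y b = vertexValL v y b' := by
  have hdefect : valueDefect v y = 0 ↔ ∀ b : Γ.Star v, vertexValL v y b = vval v y := by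
    rw [funext_iff]
    exact forall_congr' fun b => sub_eq_zero
  exact hdefect.trans ⟨fun h b b' => (h b).trans (h b').symm, vval_eq_of_forall_eq⟩

/-- The vector `A F(u) + B F'(u)`. -/
noncomputable def conditionDefect (u : V) (S : SelfAdjointCondition (Γ.Star u)) :
    Γ.H2Data →L[ℂ] (Γ.Star u → ℂ) :=
  S.A.mulVecLin.toContinuousLinearMap.comp (vertexValL u)
    + S.B.mulVecLin.toContinuousLinearMap.comp (vertexDerivL u)

theorem conditionDefect_apply (u : V) (S : SelfAdjointCondition (Γ.Star u)) (y : Γ.H2Data) :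
    conditionDefect u S y = S.A *ᵥ vertexValL u y + S.B *ᵥ vertexDerivL u y := rfl

end VertexData

section Domain

variable {V E : Type*} {Γ : MetricGraph V E} [Fintype E] [DecidableEq V] (v : V)
  (bc : ∀ u : V, u ≠ v → SelfAdjointCondition (Γ.Star u))

/-- The functions that are continuous at `v` and satisfy the given conditions at all other
vertices: the part of the vertex conditions of `Γ_α` that does not depend on `α`. -/
noncomputable def partialDomain : Submodule ℂ Γ.H2Data :=
  (valueDefect v).ker ⊓ ⨅ u, ⨅ hu : u ≠ v, (conditionDefect u (bc u hu)).ker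

/-- The domain of the Hamiltonian of `Γ_α`. -/
noncomputable def domain (α : WithTop ℝ) : Submodule ℂ Γ.H2Data :=
  partialDomain v bc ⊓ (deltaDefect v α).ker

variable {v bc}

theorem mem_partialDomain_iff {y : Γ.H2Data} : y ∈ partialDomain v bc ↔
    valueDefect v y = 0 ∧ ∀ (u : V) (hu : u ≠ v), conditionDefect u (bc u hu) y = 0 := by
  simp [partialDomain]

theorem mem_domain_iff {α : WithTop ℝ} {y : Γ.H2Data} :
    y ∈ domain v bc α ↔ y ∈ partialDomain v bc ∧ deltaDefect v α y = 0 := Iff.rfl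

theorem vertexValL_of_mem_partialDomain {y : Γ.H2Data} (hy : y ∈ partialDomain v bc) :
    vertexValL v y = fun _ => vval v y :=
  funext (vval_eq_of_forall_eq (valueDefect_eq_zero_iff.1 (mem_partialDomain_iff.1 hy).1))

theorem deltaCondition_ofData_iff {α : WithTop ℝ} {y : Γ.H2Data} :
    DeltaCondition (ofData y) v α ↔ valueDefect v y = 0 ∧ deltaDefect v α y = 0 := by
  unfold DeltaCondition
  rw [vertexVal_ofData, vertexDeriv_ofData, valueDefect_eq_zero_iff]
  refine and_congr_right fun hcont => ?_
  rcases isEmpty_or_nonempty (Γ.Star v) with hempty | hnonempty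
  · cases α <;> simp [deltaDefect_eq_zero_of_isEmpty]
  · simp only [vval_eq_of_forall_eq hcont, ← vder_apply, forall_const]
    cases α with
    | top => rfl
    | coe a => rw [deltaDefect_coe, sub_eq_zero]

theorem vertexConditions_ofData_iff {α : WithTop ℝ} {y : Γ.H2Data} :
    VertexConditions v bc α (ofData y) ↔ y ∈ domain v bc α := by
  rw [VertexConditions, deltaCondition_ofData_iff, mem_domain_iff, mem_partialDomain_iff,
    and_right_comm]
  simp only [vertexVal_ofData, vertexDeriv_ofData, conditionDefect_apply]

variable (v bc)

/-- All vertex conditions of `Γ_α` as a square system of linear equations, one for each edge end. -/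
noncomputable def boundaryDefect (α : WithTop ℝ) : Γ.H2Data →L[ℂ] (E × Bool → ℂ) :=
  ContinuousLinearMap.pi fun b =>
    if hb : Γ.endpt b.1 b.2 = v then
      (ContinuousLinearMap.proj ⟨b, hb⟩).comp (valueDefect v) + deltaDefect v α
    else (ContinuousLinearMap.proj ⟨b, rfl⟩).comp (conditionDefect _ (bc _ hb))

theorem boundaryDefect_apply_star (α : WithTop ℝ) (y : Γ.H2Data) (b : Γ.Star v) :
    boundaryDefect v bc α y b.1 = valueDefect v y b + deltaDefect v α y := by
  simp [boundaryDefect, b.2]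

theorem boundaryDefect_apply_of_ne (α : WithTop ℝ) (y : Γ.H2Data) {u : V} (hu : u ≠ v)
    (b : Γ.Star u) : boundaryDefect v bc α y b.1 = conditionDefect u (bc u hu) y b := by
  obtain ⟨b, rfl⟩ := b
  simp [boundaryDefect, hu]

theorem sum_valueDefect (y : Γ.H2Data) : ∑ b, valueDefect v y b = 0 := by
  have hsum : ∑ b, valueDefect v y b
      = ∑ b, vertexValL v y b - Fintype.card (Γ.Star v) * vval v y := by
    simp [valueDefect, Finset.sum_sub_distrib]
  rcases isEmpty_or_nonempty (Γ.Star v) with hempty | hnonempty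
  · exact Finset.sum_of_isEmpty _
  · rw [hsum, vval_apply, mul_inv_cancel_left₀ (Nat.cast_ne_zero.2 Fintype.card_ne_zero), sub_self]

theorem boundaryDefect_eq_zero_iff {α : WithTop ℝ} {y : Γ.H2Data} :
    boundaryDefect v bc α y = 0 ↔ y ∈ domain v bc α := by
  rw [mem_domain_iff, mem_partialDomain_iff]
  constructor
  · intro h
    have hstar (b : Γ.Star v) : valueDefect v y b + deltaDefect v α y = 0 := by
      rw [← boundaryDefect_apply_star v bc, h, Pi.zero_apply]
    have hdelta : deltaDefect v α y = 0 := by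
      rcases isEmpty_or_nonempty (Γ.Star v) with hempty | hnonempty
      · exact deltaDefect_eq_zero_of_isEmpty v α y
      · have hsum := Fintype.sum_eq_zero _ hstar
        rw [Finset.sum_add_distrib, sum_valueDefect, zero_add, Finset.sum_const,
          Finset.card_univ] at hsum
        exact (smul_eq_zero.1 hsum).resolve_left Fintype.card_ne_zero
    refine ⟨⟨funext fun b => ?_, fun u hu => funext fun b => ?_⟩, hdelta⟩
    · simpa only [hdelta, add_zero, Pi.zero_apply] using hstar b
    · rw [← boundaryDefect_apply_of_ne v bc α y hu, h]
      rfl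
  · rintro ⟨⟨hvalue, hcond⟩, hdelta⟩
    funext b
    by_cases hb : Γ.endpt b.1 b.2 = v
    · rw [boundaryDefect_apply_star v bc α y ⟨b, hb⟩, hvalue, hdelta]
      exact add_zero _
    · rw [boundaryDefect_apply_of_ne v bc α y hb ⟨b, rfl⟩, hcond]
      rfl

end Domain

section Green

variable {V E : Type*} {Γ : MetricGraph V E} [Fintype E] [DecidableEq V] {v : V}
  {bc : ∀ u : V, u ≠ v → SelfAdjointCondition (Γ.Star u)}

theorem vertexDerivL_dotProduct_star {y z : Γ.H2Data} (hz : z ∈ partialDomain v bc) :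
    vertexDerivL v y ⬝ᵥ star (vertexValL v z) = vder v y * conj (vval v z) := by
  rw [vertexValL_of_mem_partialDomain hz, vder_apply, Finset.sum_mul]
  rfl

theorem vertexValL_dotProduct_star {y z : Γ.H2Data} (hy : y ∈ partialDomain v bc) :
    vertexValL v y ⬝ᵥ star (vertexDerivL v z) = vval v y * conj (vder v z) := by
  rw [vertexValL_of_mem_partialDomain hy, vder_apply, map_sum, Finset.mul_sum]
  rfl

theorem norm_vval_sq_le {y : Γ.H2Data} (hy : y ∈ partialDomain v bc) :
    ‖vval v y‖ ^ 2 ≤ ∑ e, ‖edgeValL e y‖ ^ 2 := by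
  rcases isEmpty_or_nonempty (Γ.Star v) with hempty | ⟨⟨b⟩⟩
  · rw [vval_apply, Finset.sum_of_isEmpty, mul_zero, norm_zero, zero_pow two_ne_zero]
    positivity
  · refine le_trans ?_ (norm_vertexValL_sq_le v y)
    rw [← congrFun (vertexValL_of_mem_partialDomain hy) b]
    gcongr
    exact norm_le_pi_norm _ b

variable [Finite V]

theorem endDerivL_dotProduct_star_sub {y z : Γ.H2Data} (hy : y ∈ partialDomain v bc)
    (hz : z ∈ partialDomain v bc) :
    endDerivL y ⬝ᵥ star (endValL z) - endValL y ⬝ᵥ star (endDerivL z)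
      = vder v y * conj (vval v z) - vval v y * conj (vder v z) := by
  have := Fintype.ofFinite V
  rw [← vertexDerivL_dotProduct_star hz, ← vertexValL_dotProduct_star hy, dotProduct, dotProduct,
    sum_eq_sum_star (Γ := Γ), sum_eq_sum_star (Γ := Γ), ← Finset.sum_sub_distrib]
  refine Fintype.sum_eq_single v fun u hu => sub_eq_zero.2 ?_
  exact (bc u hu).dotProduct_star_comm ((mem_partialDomain_iff.1 hy).2 u hu)
    ((mem_partialDomain_iff.1 hz).2 u hu)

theorem inner_hamL2_sub_of_mem_partialDomain {W : E → ℝ → ℝ}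
    (hW : ∀ e, MemLp (W e) 2 (volume.restrict (Ioc 0 (Γ.len e)))) (κ : ℝ) {y z : Γ.H2Data}
    (hy : y ∈ partialDomain v bc) (hz : z ∈ partialDomain v bc) :
    inner ℂ (toL2 z) (hamL2 hW κ y) - inner ℂ (hamL2 hW κ z) (toL2 y)
      = vder v y * conj (vval v z) - vval v y * conj (vder v z) := by
  rw [inner_toL2_hamL2_sub, endDerivL_dotProduct_star_sub hy hz]

variable (v bc)

theorem exists_norm_endDerivL_dotProduct_star_sub_le :
    ∃ C : ℝ, ∀ y ∈ partialDomain v bc,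
      ‖endDerivL y ⬝ᵥ star (endValL y) - vder v y * conj (vval v y)‖
        ≤ C * ∑ e, ‖edgeValL e y‖ ^ 2 := by
  have := Fintype.ofFinite V
  have at_vertex (u : V) : ∃ C : ℝ, ∀ y ∈ partialDomain v bc,
      ‖vertexDerivL u y ⬝ᵥ star (vertexValL u y)
        - if u = v then vder v y * conj (vval v y) else 0‖ ≤ C * ∑ e, ‖edgeValL e y‖ ^ 2 := by
    rcases eq_or_ne u v with rfl | hu
    · refine ⟨0, fun y hy => ?_⟩
      rw [if_pos rfl, vertexDerivL_dotProduct_star hy, sub_self, norm_zero, zero_mul]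
    · obtain ⟨C, hC⟩ := (bc u hu).exists_norm_dotProduct_star_le
      refine ⟨|C|, fun y hy => ?_⟩
      rw [if_neg hu, sub_zero]
      calc ‖vertexDerivL u y ⬝ᵥ star (vertexValL u y)‖ ≤ C * ‖vertexValL u y‖ ^ 2 :=
            hC _ _ ((mem_partialDomain_iff.1 hy).2 u hu)
        _ ≤ |C| * ∑ e, ‖edgeValL e y‖ ^ 2 := by
            gcongr
            exacts [le_abs_self C, norm_vertexValL_sq_le u y]
  choose C hC using at_vertex
  refine ⟨∑ u, C u, fun y hy => ?_⟩
  have hsplit : endDerivL y ⬝ᵥ star (endValL y) - vder v y * conj (vval v y)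
      = ∑ u, (vertexDerivL u y ⬝ᵥ star (vertexValL u y)
        - if u = v then vder v y * conj (vval v y) else 0) := by
    rw [Finset.sum_sub_distrib, Finset.sum_ite_eq', if_pos (Finset.mem_univ v), dotProduct,
      sum_eq_sum_star (Γ := Γ)]
    rfl
  rw [hsplit, Finset.sum_mul]
  exact norm_sum_le_of_le _ fun u _ => hC u y hy

theorem eventually_le_re_inner_hamL2 {W : E → ℝ → ℝ}
    (hW : ∀ e, MemLp (W e) 2 (volume.restrict (Ioc 0 (Γ.len e)))) (C : ℝ) :
    ∀ᶠ κ in Filter.atTop, ∀ y ∈ partialDomain v bc,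
      (vder v y * conj (vval v y)).re + C * ‖vval v y‖ ^ 2 + ‖toL2 y‖ ^ 2
        ≤ (inner ℂ (toL2 y) (hamL2 hW κ y)).re := by
  obtain ⟨C', hC'⟩ := exists_norm_endDerivL_dotProduct_star_sub_le v bc
  filter_upwards [eventually_sum_norm_edgeValL_le_form hW (|C| + C')] with κ hκ y hy
  have hform := hκ y
  have hother := (abs_le.1 ((Complex.abs_re_le_norm _).trans (hC' y hy))).1
  have hvval : C * ‖vval v y‖ ^ 2 ≤ |C| * ∑ e, ‖edgeValL e y‖ ^ 2 := by
    gcongr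
    exacts [le_abs_self C, norm_vval_sq_le hy]
  rw [Complex.sub_re] at hother
  rw [inner_toL2_hamL2, Complex.add_re]
  linarith

end Green

end MetricGraph

theorem isUnit_of_isCompactOperator_add_one {𝕜 X : Type*} [NontriviallyNormedField 𝕜]
    [NormedAddCommGroup X] [NormedSpace 𝕜 X] [CompleteSpace X] {A : X →L[𝕜] X}
    (hA : IsCompactOperator (A + 1 : X →L[𝕜] X)) (h : ∀ x, A x = 0 → x = 0) : IsUnit A := by
  have not_hasEigenvalue :
      ¬ Module.End.HasEigenvalue ((A + 1 : X →L[𝕜] X) : Module.End 𝕜 X) 1 := by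
    intro hone
    obtain ⟨x, hx, hx0⟩ := hone.exists_hasEigenvector
    refine hx0 (h x ?_)
    simpa using Module.End.mem_eigenspace_iff.1 hx
  have hunit := (IsCompactOperator.hasEigenvalue_or_mem_resolventSet hA
    (one_ne_zero (α := 𝕜))).resolve_left not_hasEigenvalue
  rw [spectrum.mem_resolventSet_iff, map_one, sub_add_cancel_right] at hunit
  exact IsUnit.neg_iff A |>.1 hunit

namespace MetricGraph

open scoped ComplexConjugate

section Delta

variable {V E : Type*} {Γ : MetricGraph V E} [Fintype E] [DecidableEq V] {v : V}

theorem vder_mul_conj_vval_comm {α : WithTop ℝ} {y z : Γ.H2Data} (hy : deltaDefect v α y = 0)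
    (hz : deltaDefect v α z = 0) : vder v y * conj (vval v z) = vval v y * conj (vder v z) := by
  cases α with
  | top =>
    rw [deltaDefect_top] at hy hz
    rw [hy, hz, map_zero, mul_zero, zero_mul]
  | coe a =>
    rw [deltaDefect_coe, sub_eq_zero] at hy hz
    rw [hy, hz, map_mul, Complex.conj_ofReal]
    ring

theorem exists_neg_le_re_vder_mul_conj_vval (v : V) (α : WithTop ℝ) :
    ∃ C : ℝ, ∀ y : Γ.H2Data, deltaDefect v α y = 0 →
      -(C * ‖vval v y‖ ^ 2) ≤ (vder v y * conj (vval v y)).re := by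
  cases α with
  | top =>
    refine ⟨0, fun y hy => ?_⟩
    rw [deltaDefect_top] at hy
    simp [hy]
  | coe a =>
    refine ⟨-a, fun y hy => ?_⟩
    rw [deltaDefect_coe, sub_eq_zero] at hy
    rw [hy, mul_assoc, Complex.mul_conj, Complex.re_ofReal_mul, Complex.ofReal_re,
      Complex.normSq_eq_norm_sq, neg_mul, neg_neg]

theorem re_deltaDefect_mul_conj_vval (a : ℝ) (y : Γ.H2Data) :
    (deltaDefect v a y * conj (vval v y)).re
      = (vder v y * conj (vval v y)).re - a * ‖vval v y‖ ^ 2 := by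
  rw [deltaDefect_coe, sub_mul, mul_assoc, Complex.mul_conj, Complex.sub_re, Complex.re_ofReal_mul,
    Complex.ofReal_re, Complex.normSq_eq_norm_sq]

theorem re_deltaDefect_mul_conj_vval_nonneg {a : ℝ} {α' : WithTop ℝ} (hα : a ≤ α') {y : Γ.H2Data}
    (hy : deltaDefect v α' y = 0) : 0 ≤ (deltaDefect v a y * conj (vval v y)).re := by
  cases α' with
  | top =>
    rw [deltaDefect_top] at hy
    rw [hy, map_zero, mul_zero, Complex.zero_re]
  | coe a' =>
    rw [re_deltaDefect_mul_conj_vval, sub_nonneg]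
    have hform := re_deltaDefect_mul_conj_vval (v := v) a' y
    rw [hy, zero_mul, Complex.zero_re, eq_comm, sub_eq_zero] at hform
    rw [hform]
    gcongr
    exact WithTop.coe_le_coe.1 hα

theorem deltaDefect_ne_zero_of_lt {a : ℝ} {α' : WithTop ℝ} (hα : a < α') {y : Γ.H2Data}
    (hy : deltaDefect v α' y = 0) (hne : vval v y ≠ 0 ∨ vder v y ≠ 0) : deltaDefect v a y ≠ 0 := by
  intro ha
  rw [deltaDefect_coe, sub_eq_zero] at ha
  suffices hval : vval v y = 0 by simp [ha, hval] at hne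
  cases α' with
  | top => exact hy
  | coe a' =>
    rw [deltaDefect_coe, sub_eq_zero, ha] at hy
    by_contra hval
    exact (WithTop.coe_lt_coe.1 hα).ne (Complex.ofReal_injective (mul_right_cancel₀ hval hy))

variable {bc : ∀ u : V, u ≠ v → SelfAdjointCondition (Γ.Star u)}

theorem mem_domain_of_vval_eq_zero {a : ℝ} {y : Γ.H2Data} (hy : y ∈ domain v bc a)
    (hval : vval v y = 0) (α' : WithTop ℝ) : y ∈ domain v bc α' := by
  refine mem_domain_iff.2 ⟨hy.1, ?_⟩
  have hder : vder v y = 0 := by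
    simpa only [deltaDefect_coe, hval, mul_zero, sub_zero] using (mem_domain_iff.1 hy).2
  cases α' with
  | top => exact hval
  | coe a' => rw [deltaDefect_coe, hval, hder, mul_zero, sub_zero]

variable {W : E → ℝ → ℝ} (hW : ∀ e, MemLp (W e) 2 (volume.restrict (Ioc 0 (Γ.len e))))

theorem inner_hamL2_sub_of_mem_domain [Finite V] (κ : ℝ) {a : ℝ} {y z : Γ.H2Data}
    (hy : y ∈ partialDomain v bc) (hz : z ∈ domain v bc a) :
    inner ℂ (toL2 z) (hamL2 hW κ y) - inner ℂ (hamL2 hW κ z) (toL2 y)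
      = deltaDefect v a y * conj (vval v z) := by
  obtain ⟨hz, hdelta⟩ := mem_domain_iff.1 hz
  rw [deltaDefect_coe, sub_eq_zero] at hdelta
  rw [inner_hamL2_sub_of_mem_partialDomain hW κ hy hz, hdelta, deltaDefect_coe, map_mul,
    Complex.conj_ofReal]
  ring

variable (v bc)

theorem eventually_norm_toL2_sq_le [Finite V] (α : WithTop ℝ) :
    ∀ᶠ κ in Filter.atTop, ∀ y ∈ domain v bc α,
      ‖toL2 y‖ ^ 2 ≤ (inner ℂ (toL2 y) (hamL2 hW κ y)).re := by
  obtain ⟨C, hC⟩ := exists_neg_le_re_vder_mul_conj_vval (Γ := Γ) v α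
  filter_upwards [eventually_le_re_inner_hamL2 v bc hW C] with κ hκ y hy
  obtain ⟨hy, hdelta⟩ := mem_domain_iff.1 hy
  linarith [hκ y hy, hC y hdelta]

theorem eventually_re_deltaDefect_mul_conj_vval_le [Finite V] (a : ℝ) :
    ∀ᶠ κ in Filter.atTop, ∀ y ∈ partialDomain v bc,
      (deltaDefect v a y * conj (vval v y)).re ≤ (inner ℂ (toL2 y) (hamL2 hW κ y)).re := by
  filter_upwards [eventually_le_re_inner_hamL2 v bc hW (-a)] with κ hκ y hy
  rw [re_deltaDefect_mul_conj_vval]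
  linarith [hκ y hy, sq_nonneg ‖toL2 y‖]

end Delta

section Resolvent

variable {V E : Type*} {Γ : MetricGraph V E} [Fintype E] [DecidableEq V] {W : E → ℝ → ℝ}

/-- `S` maps `g ∈ L²(Γ)` to the data of `(H + κ)⁻¹ g`, where `H` is the Hamiltonian of `Γ_α`. -/
structure IsResolvent (hW : ∀ e, MemLp (W e) 2 (volume.restrict (Ioc 0 (Γ.len e)))) (κ : ℝ) (v : V)
    (bc : ∀ u : V, u ≠ v → SelfAdjointCondition (Γ.Star u)) (α : WithTop ℝ)
    (S : Γ.L2 →L[ℂ] Γ.H2Data) : Prop where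
  mem_domain : ∀ g, S g ∈ domain v bc α
  hamL2_apply : ∀ g, hamL2 hW κ (S g) = g
  apply_hamL2 : ∀ y ∈ domain v bc α, S (hamL2 hW κ y) = y

variable {hW : ∀ e, MemLp (W e) 2 (volume.restrict (Ioc 0 (Γ.len e)))} {κ : ℝ} {v : V}
  {bc : ∀ u : V, u ≠ v → SelfAdjointCondition (Γ.Star u)} {α : WithTop ℝ}
  {S : Γ.L2 →L[ℂ] Γ.H2Data}

theorem isCompactOperator_boundaryDefect_prod_hamL2_add_one :
    IsCompactOperator
      ((boundaryDefect v bc α).prod (hamL2 hW κ) + 1 : Γ.H2Data →L[ℂ] Γ.H2Data) := by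
  have hsplit : ((boundaryDefect v bc α).prod (hamL2 hW κ) + 1 : Γ.H2Data →L[ℂ] Γ.H2Data)
      = (ContinuousLinearMap.inl ℂ (E × Bool → ℂ) Γ.L2).comp
          (boundaryDefect v bc α + ContinuousLinearMap.fst ℂ _ _)
        + (ContinuousLinearMap.inr ℂ (E × Bool → ℂ) Γ.L2).comp (edgewise (edgePotential hW κ)) := by
    refine ContinuousLinearMap.ext fun y => Prod.ext ?_ ?_
    · exact (add_zero _).symm
    · exact (sub_add_cancel _ _).trans (zero_add _).symm
  have boundary_part := (isCompactOperator_of_locallyCompactSpace_dom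
    (boundaryDefect v bc α + ContinuousLinearMap.fst ℂ _ _)).clm_comp
    (ContinuousLinearMap.inl ℂ (E × Bool → ℂ) Γ.L2)
  have potential_part := (isCompactOperator_edgewise (edgePotential hW κ)).clm_comp
    (ContinuousLinearMap.inr ℂ (E × Bool → ℂ) Γ.L2)
  rw [hsplit]
  exact boundary_part.add potential_part

theorem exists_isResolvent (hform : ∀ y ∈ domain v bc α,
    ‖toL2 y‖ ^ 2 ≤ (inner ℂ (toL2 y) (hamL2 hW κ y)).re) : ∃ S, IsResolvent hW κ v bc α S := by
  obtain ⟨U, hU⟩ := isUnit_of_isCompactOperator_add_one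
    (isCompactOperator_boundaryDefect_prod_hamL2_add_one (hW := hW) (κ := κ) (bc := bc) (α := α))
    fun y hy => by
      obtain ⟨hboundary, hham⟩ := Prod.ext_iff.1 hy
      have hnorm := hform y ((boundaryDefect_eq_zero_iff v bc).1 hboundary)
      rw [show hamL2 hW κ y = 0 from hham, inner_zero_right, Complex.zero_re,
        sq_nonpos_iff, norm_eq_zero] at hnorm
      exact toL2_injective (hnorm.trans (map_zero toL2).symm)
  let A := ContinuousLinearEquiv.unitsEquiv ℂ Γ.H2Data U
  have A_apply (y : Γ.H2Data) : A y = (boundaryDefect v bc α y, hamL2 hW κ y) :=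
    DFunLike.congr_fun hU y
  have A_symm (g : Γ.L2) := (A_apply (A.symm (0, g))).symm.trans (A.apply_symm_apply (0, g))
  refine ⟨(A.symm : Γ.H2Data →L[ℂ] Γ.H2Data).comp (ContinuousLinearMap.inr ℂ _ _),
    fun g => (boundaryDefect_eq_zero_iff v bc).1 (congrArg Prod.fst (A_symm g)),
    fun g => congrArg Prod.snd (A_symm g), fun y hy => A.symm_apply_eq.2 ?_⟩
  rw [A_apply, (boundaryDefect_eq_zero_iff v bc).2 hy]
  rfl

theorem IsResolvent.isCompactPosDef [Finite V] (hS : IsResolvent hW κ v bc α S)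
    (hform : ∀ y ∈ domain v bc α, ‖toL2 y‖ ^ 2 ≤ (inner ℂ (toL2 y) (hamL2 hW κ y)).re) :
    IsCompactPosDef (toL2.comp S) where
  isCompactOperator := (isCompactOperator_edgewise _).comp_clm S
  isSymmetric g h := by
    have green := inner_hamL2_sub_of_mem_partialDomain hW κ (hS.mem_domain h).1 (hS.mem_domain g).1
    rw [vder_mul_conj_vval_comm (hS.mem_domain h).2 (hS.mem_domain g).2, sub_self, hS.hamL2_apply,
      hS.hamL2_apply] at green
    exact sub_eq_zero.1 green
  re_inner_pos g hg := by
    have hnorm := hform (S g) (hS.mem_domain g)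
    rw [hS.hamL2_apply] at hnorm
    refine lt_of_lt_of_le (pow_pos (norm_pos_iff.2 fun hzero => hg ?_) 2) hnorm
    rw [← hS.hamL2_apply g, toL2_injective (hzero.trans (map_zero toL2).symm), map_zero]

theorem eventually_exists_isResolvent [Finite V]
    (hW : ∀ e, MemLp (W e) 2 (volume.restrict (Ioc 0 (Γ.len e)))) (v : V)
    (bc : ∀ u : V, u ≠ v → SelfAdjointCondition (Γ.Star u)) (α : WithTop ℝ) :
    ∀ᶠ κ in Filter.atTop, ∃ S, IsResolvent hW κ v bc α S ∧ IsCompactPosDef (toL2.comp S) := by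
  filter_upwards [eventually_norm_toL2_sq_le v bc hW α] with κ hform
  obtain ⟨S, hS⟩ := exists_isResolvent hform
  exact ⟨S, hS, hS.isCompactPosDef hform⟩

theorem IsResolvent.re_inner_le [Finite V] {a : ℝ} {α' : WithTop ℝ} (hα : a ≤ α')
    {S' : Γ.L2 →L[ℂ] Γ.H2Data} (hS : IsResolvent hW κ v bc a S) (hS' : IsResolvent hW κ v bc α' S')
    (hform : ∀ y ∈ partialDomain v bc,
      (deltaDefect v a y * conj (vval v y)).re ≤ (inner ℂ (toL2 y) (hamL2 hW κ y)).re) (g : Γ.L2) :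
    (inner ℂ (toL2.comp S' g) g).re ≤ (inner ℂ (toL2.comp S g) g).re := by
  have green := inner_hamL2_sub_of_mem_domain hW κ (hS'.mem_domain g).1 (hS.mem_domain g)
  have hdiff := hform (S g - S' g) (sub_mem (hS.mem_domain g).1 (hS'.mem_domain g).1)
  have hdelta : deltaDefect v a (S g) = 0 := (mem_domain_iff.1 (hS.mem_domain g)).2
  have hnonneg := re_deltaDefect_mul_conj_vval_nonneg hα (mem_domain_iff.1 (hS'.mem_domain g)).2
  rw [hS.hamL2_apply, hS'.hamL2_apply] at green
  rw [map_sub (hamL2 hW κ), hS.hamL2_apply, hS'.hamL2_apply, sub_self, inner_zero_right, map_sub,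
    hdelta, map_sub, map_sub, zero_sub, neg_mul, mul_sub, Complex.zero_re, Complex.neg_re,
    Complex.sub_re, ← green, Complex.sub_re] at hdiff
  have hsymm : (inner ℂ g (toL2 (S' g))).re = (inner ℂ (toL2 (S' g)) g).re :=
    inner_re_symm (𝕜 := ℂ) g _
  simp only [ContinuousLinearMap.comp_apply]
  linarith

theorem IsResolvent.apply_eq_of_vval_eq_zero {a : ℝ} {α' : WithTop ℝ} {S' : Γ.L2 →L[ℂ] Γ.H2Data}
    (hS : IsResolvent hW κ v bc a S) (hS' : IsResolvent hW κ v bc α' S') {g : Γ.L2}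
    (hg : vval v (S g) = 0) : S' g = S g := by
  rw [← hS'.apply_hamL2 _ (mem_domain_of_vval_eq_zero (hS.mem_domain g) hg α'), hS.hamL2_apply]

end Resolvent

section Spectrum

variable {V E : Type*} {Γ : MetricGraph V E}

theorem not_finiteDimensional_L2 [Nonempty E] : ¬ FiniteDimensional ℂ Γ.L2 := by
  classical
  intro _
  let e : E := Classical.arbitrary E
  refine not_finiteDimensional_intervalL2 (Γ.len_pos e) (Module.Finite.of_surjective
    (PiLp.proj (𝕜 := ℂ) 2 (fun e => IntervalL2 (Γ.len e)) e : Γ.L2 →ₗ[ℂ] IntervalL2 (Γ.len e))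
    fun g => ⟨WithLp.toLp 2 (Pi.single e g), ?_⟩)
  exact Pi.single_eq_same (M := fun e => IntervalL2 (Γ.len e)) e g

variable [Fintype E] {W : E → ℝ → ℝ}

theorem hamL2_eq_smul_toL2_iff (hW : ∀ e, MemLp (W e) 2 (volume.restrict (Ioc 0 (Γ.len e))))
    (κ : ℝ) {μ : ℂ} {y : Γ.H2Data} : hamL2 hW κ y = (μ + κ) • toL2 y ↔
      ∀ e, ∀ᵐ x ∂volume.restrict (Ioc 0 (Γ.len e)),
        onEdge (μ • ofData y) e x = -y.2 e x + (W e x : ℂ) * onEdge (ofData y) e x := by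
  rw [PiLp.ext_iff]
  refine forall_congr' fun e => ?_
  rw [Lp.ext_iff]
  refine Filter.eventually_congr ?_
  filter_upwards [Lp.coeFn_sub (edgePotential hW κ e (edgeValL e y)) (y.2 e),
    coeFn_edgePotential hW κ e (edgeValL e y), Lp.coeFn_smul (μ + κ) (toL2 y e),
    coeFn_inclL2 (Γ.len_pos e).le (edgeValL e y)] with x hsub hpot hsmul hincl
  rw [hamL2_apply, PiLp.smul_apply, hsub, hsmul, Pi.sub_apply, Pi.smul_apply, hpot, toL2_apply,
    hincl, onEdge_smul, Pi.smul_apply, ← onEdge_ofData, smul_eq_mul, smul_eq_mul]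
  push_cast
  constructor <;> intro h <;> linear_combination -h

variable [DecidableEq V] {v : V} {bc : ∀ u : V, u ≠ v → SelfAdjointCondition (Γ.Star u)}
  {α : WithTop ℝ}

theorem mem_eigenspace_iff (hW : ∀ e, MemLp (W e) 2 (volume.restrict (Ioc 0 (Γ.len e)))) (κ : ℝ)
    {μ : ℂ} {f : Γ.Fun} : f ∈ eigenspace W v bc α μ ↔
      ∃ y ∈ domain v bc α, ofData y = f ∧ hamL2 hW κ y = (μ + κ) • toL2 y := by
  constructor
  · rintro ⟨hdomain, hmaps⟩
    choose g hg hmaps using hmaps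
    obtain ⟨y, rfl, hy⟩ := exists_ofData_eq hg
    refine ⟨y, vertexConditions_ofData_iff.1 hdomain, rfl,
      (hamL2_eq_smul_toL2_iff hW κ).2 fun e => ?_⟩
    filter_upwards [hmaps e, hy e] with x hx hyx
    rw [hx, hyx]
  · rintro ⟨y, hdomain, rfl, hmaps⟩
    exact ⟨vertexConditions_ofData_iff.2 hdomain, fun e =>
      ⟨y.2 e, hasSecondDeriv_ofData y e, (hamL2_eq_smul_toL2_iff hW κ).1 hmaps e⟩⟩

variable {hW : ∀ e, MemLp (W e) 2 (volume.restrict (Ioc 0 (Γ.len e)))} {κ : ℝ}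
  {S : Γ.L2 →L[ℂ] Γ.H2Data}

namespace IsResolvent

theorem injective (hS : IsResolvent hW κ v bc α S) : Function.Injective S :=
  Function.LeftInverse.injective (g := hamL2 hW κ) hS.hamL2_apply

theorem toL2_apply_eq_inv_smul_iff (hS : IsResolvent hW κ v bc α S) {s : ℂ} {g : Γ.L2} :
    toL2 (S g) = s⁻¹ • g ↔ g = s • toL2 (S g) := by
  rcases eq_or_ne s 0 with rfl | hs
  · rw [inv_zero, zero_smul, zero_smul, map_eq_zero_iff _ toL2_injective,
      map_eq_zero_iff _ hS.injective]
  · rw [eq_inv_smul_iff₀ hs, eq_comm]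

theorem eigenspace_eq_map (hS : IsResolvent hW κ v bc α S) (μ : ℂ) :
    eigenspace W v bc α μ = (Module.End.eigenspace (toL2.comp S : Module.End ℂ Γ.L2) (μ + κ)⁻¹).map
      (ofData ∘ₗ (S : Γ.L2 →ₗ[ℂ] Γ.H2Data)) := by
  ext f
  rw [mem_eigenspace_iff hW κ, Submodule.mem_map]
  constructor
  · rintro ⟨y, hy, rfl, hmaps⟩
    refine ⟨hamL2 hW κ y, Module.End.mem_eigenspace_iff.2 (hS.toL2_apply_eq_inv_smul_iff.2 ?_),
      congrArg ofData (hS.apply_hamL2 y hy)⟩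
    rw [hS.apply_hamL2 y hy, hmaps]
  · rintro ⟨g, hg, rfl⟩
    refine ⟨S g, hS.mem_domain g, rfl, (hS.hamL2_apply g).trans ?_⟩
    exact hS.toL2_apply_eq_inv_smul_iff.1 (Module.End.mem_eigenspace_iff.1 hg)

theorem rank_eigenspace (hS : IsResolvent hW κ v bc α S) (μ : ℂ) :
    Module.rank ℂ (eigenspace W v bc α μ)
      = Module.rank ℂ (Module.End.eigenspace (toL2.comp S : Module.End ℂ Γ.L2) (μ + κ)⁻¹) := by
  have injective_comp : Function.Injective (ofData ∘ₗ (S : Γ.L2 →ₗ[ℂ] Γ.H2Data)) :=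
    fun _ _ h => hS.injective (ofData_injective h)
  rw [hS.eigenspace_eq_map]
  exact (Submodule.equivMapOfInjective _ injective_comp _).rank_eq.symm

theorem encard_eq_rank_iff (hS : IsResolvent hW κ v bc α S) (lam : ℕ → ℝ) :
    (∀ μ : ℂ, {n : ℕ | (lam n : ℂ) = μ}.encard
      = Cardinal.toENat (Module.rank ℂ (eigenspace W v bc α μ))) ↔
    ∀ s : ℂ, {n : ℕ | (((lam n + κ)⁻¹ : ℝ) : ℂ) = s}.encard = Cardinal.toENat
      (Module.rank ℂ (Module.End.eigenspace (toL2.comp S : Module.End ℂ Γ.L2) s)) := by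
  have inv_add_surjective : Function.Surjective fun μ : ℂ => (μ + κ)⁻¹ :=
    fun s => ⟨s⁻¹ - κ, by simp⟩
  refine (forall_congr' fun μ => ?_).trans inv_add_surjective.forall.symm
  simp only [hS.rank_eigenspace, Complex.ofReal_inv, Complex.ofReal_add, inv_inj, add_left_inj]

end IsResolvent

theorem IsEigenvalueSequence.eigenspace_ne_bot {lam : ℕ → ℝ}
    (hlam : IsEigenvalueSequence W v bc α lam) (n : ℕ) : eigenspace W v bc α (lam n) ≠ ⊥ := by
  intro hbot
  have hcard := hlam.2 (lam n)
  rw [hbot, rank_bot, map_zero, encard_eq_zero] at hcard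
  exact (hcard ▸ (rfl : (lam n : ℂ) = lam n) : n ∈ (∅ : Set ℕ))

theorem IsResolvent.add_pos (hS : IsResolvent hW κ v bc α S)
    (hT : IsCompactPosDef (toL2.comp S)) {lam : ℕ → ℝ} (hlam : IsEigenvalueSequence W v bc α lam)
    (n : ℕ) : 0 < lam n + κ := by
  have hne := hlam.eigenspace_ne_bot n
  rw [hS.eigenspace_eq_map] at hne
  obtain ⟨g, hg, hg0⟩ := Submodule.exists_mem_ne_zero_of_ne_bot (ne_of_apply_ne
    (Submodule.map _) (hne.trans_eq (Submodule.map_bot _).symm))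
  have hpos := (hT.eigenvalue_eq_ofReal hg0 (Module.End.mem_eigenspace_iff.1 hg)).1
  rwa [← Complex.ofReal_add, ← Complex.ofReal_inv, RCLike.re_eq_complex_re, Complex.ofReal_re,
    inv_pos] at hpos

theorem IsResolvent.isEigenvalueList (hS : IsResolvent hW κ v bc α S)
    (hT : IsCompactPosDef (toL2.comp S)) {lam : ℕ → ℝ}
    (hlam : IsEigenvalueSequence W v bc α lam) :
    IsEigenvalueList (toL2.comp S) fun n => (lam n + κ)⁻¹ where
  antitone m n hmn := inv_anti₀ (hS.add_pos hT hlam m) (by gcongr; exact hlam.1 hmn)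
  encard_eq := (hS.encard_eq_rank_iff lam).1 hlam.2

theorem exists_isEigenvalueSequence [Finite V] [Nonempty E]
    (hW : ∀ e, MemLp (W e) 2 (volume.restrict (Ioc 0 (Γ.len e)))) (v : V)
    (bc : ∀ u : V, u ≠ v → SelfAdjointCondition (Γ.Star u)) (α : WithTop ℝ) :
    ∃ lam : ℕ → ℝ, IsEigenvalueSequence W v bc α lam := by
  obtain ⟨κ, S, hS, hT⟩ := (eventually_exists_isResolvent hW v bc α).exists
  obtain ⟨τ, hτ, hpos⟩ := hT.exists_isEigenvalueList not_finiteDimensional_L2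
  refine ⟨fun n => (τ n)⁻¹ - κ, fun m n hmn => ?_, (hS.encard_eq_rank_iff _).2 ?_⟩
  · exact sub_le_sub_right (inv_anti₀ (hpos n) (hτ.antitone hmn)) κ
  · simp only [sub_add_cancel, inv_inv]
    exact hτ.encard_eq

theorem IsResolvent.le_of_re_inner_le {α' : WithTop ℝ} {S' : Γ.L2 →L[ℂ] Γ.H2Data}
    (hS : IsResolvent hW κ v bc α S) (hS' : IsResolvent hW κ v bc α' S')
    (hT : IsCompactPosDef (toL2.comp S)) (hT' : IsCompactPosDef (toL2.comp S')) {lam lam' : ℕ → ℝ}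
    (hlam : IsEigenvalueSequence W v bc α lam) (hlam' : IsEigenvalueSequence W v bc α' lam')
    {m : ℕ} (φ : Γ.L2 →ₗ[ℂ] (Fin m → ℂ))
    (h : ∀ g, φ g = 0 → (inner ℂ (toL2.comp S' g) g).re ≤ (inner ℂ (toL2.comp S g) g).re) (n : ℕ) :
    lam n ≤ lam' (n + m) := by
  have hle := (hS.isEigenvalueList hT hlam).le_of_re_inner_le hT hT'
    (hS'.isEigenvalueList hT' hlam') φ h n
  rwa [inv_le_inv₀ (hS'.add_pos hT' hlam' _) (hS.add_pos hT hlam n), add_le_add_iff_right] at hle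

end Spectrum

section Interlacing

variable {V E : Type*} {Γ : MetricGraph V E} [Finite V] [Fintype E] [DecidableEq V]
  {W : E → ℝ → ℝ} {v : V} {bc : ∀ u : V, u ≠ v → SelfAdjointCondition (Γ.Star u)} {a : ℝ}
  {α' : WithTop ℝ} {lam lam' : ℕ → ℝ}
  (hW : ∀ e, MemLp (W e) 2 (volume.restrict (Ioc 0 (Γ.len e))))

include hW

theorem IsEigenvalueSequence.le (hlam : IsEigenvalueSequence W v bc a lam)
    (hlam' : IsEigenvalueSequence W v bc α' lam') (hα : a ≤ α') (n : ℕ) : lam n ≤ lam' n := by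
  obtain ⟨κ, ⟨⟨S, hS, hT⟩, S', hS', hT'⟩, hform⟩ := ((eventually_exists_isResolvent hW v bc a).and
    (eventually_exists_isResolvent hW v bc α')).and
    (eventually_re_deltaDefect_mul_conj_vval_le v bc hW a) |>.exists
  exact hS.le_of_re_inner_le hS' hT hT' hlam hlam' (0 : Γ.L2 →ₗ[ℂ] (Fin 0 → ℂ))
    (fun g _ => hS.re_inner_le hα hS' hform g) n

theorem IsEigenvalueSequence.le_succ (hlam : IsEigenvalueSequence W v bc a lam)
    (hlam' : IsEigenvalueSequence W v bc α' lam') (n : ℕ) : lam' n ≤ lam (n + 1) := by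
  obtain ⟨κ, ⟨S, hS, hT⟩, S', hS', hT'⟩ := (eventually_exists_isResolvent hW v bc a).and
    (eventually_exists_isResolvent hW v bc α') |>.exists
  refine hS'.le_of_re_inner_le hS hT' hT hlam' hlam
    (LinearMap.pi fun _ : Fin 1 => ((vval v).comp S : Γ.L2 →ₗ[ℂ] ℂ)) (fun g hg => ?_) n
  have hval : vval v (S g) = 0 := congrFun hg 0
  rw [ContinuousLinearMap.comp_apply, ContinuousLinearMap.comp_apply,
    hS.apply_eq_of_vval_eq_zero hS' hval]

theorem deltaDefect_mul_conj_vval_eq_zero {μ : ℝ} {y z : Γ.H2Data} (hy : y ∈ partialDomain v bc)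
    (hz : z ∈ domain v bc a) (hμy : hamL2 hW 0 y = (μ : ℂ) • toL2 y)
    (hμz : hamL2 hW 0 z = (μ : ℂ) • toL2 z) : deltaDefect v a y * conj (vval v z) = 0 := by
  rw [← inner_hamL2_sub_of_mem_domain hW 0 hy hz, hμy, hμz, inner_smul_left, inner_smul_right,
    Complex.conj_ofReal, sub_self]

theorem eigenspace_eq_bot_of_finrank_eq_one (hα : a < α') {μ : ℝ}
    (hsimple : Module.finrank ℂ (eigenspace W v bc α' μ) = 1) {f : Γ.Fun}
    (hf : f ∈ eigenspace W v bc α' μ)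
    (hv : (∃ b : Γ.Star v, vertexVal f v b ≠ 0) ∨ ∑ b : Γ.Star v, vertexDeriv f v b ≠ 0) :
    eigenspace W v bc a μ = ⊥ := by
  simp only [Submodule.eq_bot_iff, mem_eigenspace_iff hW 0, Complex.ofReal_zero, add_zero]
  rintro - ⟨z, hz, rfl, hμz⟩
  obtain ⟨y, hy, rfl, hμy⟩ := (mem_eigenspace_iff hW 0).1 hf
  rw [Complex.ofReal_zero, add_zero] at hμy
  rw [vertexVal_ofData, vertexDeriv_ofData, ← vder_apply,
    vertexValL_of_mem_partialDomain hy.1] at hv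
  have defect_ne : deltaDefect v a y ≠ 0 :=
    deltaDefect_ne_zero_of_lt hα hy.2 (hv.imp_left fun ⟨_, hval⟩ => hval)
  have vval_eq : vval v z = 0 := (map_eq_zero _).1
    ((mul_eq_zero.1 (deltaDefect_mul_conj_vval_eq_zero hW hy.1 hz hμy hμz)).resolve_left defect_ne)
  have mem_eigenspace : ofData z ∈ eigenspace W v bc α' μ := (mem_eigenspace_iff hW 0).2
    ⟨z, mem_domain_of_vval_eq_zero hz vval_eq α', rfl, by rw [Complex.ofReal_zero, add_zero, hμz]⟩
  have ofData_ne : (⟨ofData y, hf⟩ : eigenspace W v bc α' μ) ≠ 0 := fun hzero => defect_ne (by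
    rw [eq_zero_of_ofData_eq_zero (congrArg Subtype.val hzero), map_zero])
  obtain ⟨c, hc⟩ := (finrank_eq_one_iff_of_nonzero' _ ofData_ne).1 hsimple ⟨_, mem_eigenspace⟩
  have ofData_eq : c • ofData y = ofData z := congrArg Subtype.val hc
  have z_eq : c • y = z := ofData_injective ((map_smul ofData c y).trans ofData_eq)
  have c_eq : c = 0 := (smul_eq_zero.1 (by
    rw [← map_smul, z_eq, (mem_domain_iff.1 hz).2])).resolve_right defect_ne
  rw [← ofData_eq, c_eq, zero_smul]

end Interlacing

end MetricGraph

theorem theorem5p1 {V E : Type*} [Finite V] [DecidableEq V] [Fintype E] [Nonempty E]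
    (Γ : MetricGraph V E) (v : V)
    (bc : ∀ u : V, u ≠ v → SelfAdjointCondition (Γ.Star u))
    (W : E → ℝ → ℝ) (hW : ∀ e, MemLp (W e) 2 (volume.restrict (Ioc 0 (Γ.len e))))
    (α : ℝ) (α' : WithTop ℝ) (hα : (α : WithTop ℝ) < α') :
    (∃ lam : ℕ → ℝ, MetricGraph.IsEigenvalueSequence W v bc α lam) ∧
    (∃ lam' : ℕ → ℝ, MetricGraph.IsEigenvalueSequence W v bc α' lam') ∧
    ∀ lam lam' : ℕ → ℝ, MetricGraph.IsEigenvalueSequence W v bc α lam →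
      MetricGraph.IsEigenvalueSequence W v bc α' lam' →
      (∀ n, lam n ≤ lam' n ∧ lam' n ≤ lam (n + 1)) ∧
      ∀ n, Module.finrank ℂ (MetricGraph.eigenspace W v bc α' (lam' n)) = 1 →
        ∀ f ∈ MetricGraph.eigenspace W v bc α' (lam' n),
          ((∃ b : Γ.Star v, MetricGraph.vertexVal f v b ≠ 0) ∨
            ∑ b : Γ.Star v, MetricGraph.vertexDeriv f v b ≠ 0) →
          lam n < lam' n ∧ lam' n < lam (n + 1) := by
  refine ⟨MetricGraph.exists_isEigenvalueSequence hW v bc α,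
    MetricGraph.exists_isEigenvalueSequence hW v bc α', fun lam lam' hlam hlam' => ?_⟩
  have lower := hlam.le hW hlam' hα.le
  have upper := hlam.le_succ hW hlam'
  refine ⟨fun n => ⟨lower n, upper n⟩, fun n hsimple f hf hv => ?_⟩
  have eigenspace_eq_bot :=
    MetricGraph.eigenspace_eq_bot_of_finrank_eq_one hW hα hsimple hf hv
  have lam_ne (m : ℕ) : lam m ≠ lam' n := fun heq =>
    hlam.eigenspace_ne_bot m (heq ▸ eigenspace_eq_bot)
  exact ⟨(lower n).lt_of_ne (lam_ne n), (upper n).lt_of_ne (lam_ne (n + 1)).symm⟩
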